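/- Let $\mathbb K$ be an algebraically closed field of characteristic $0$, let $m\ge 2$ and $n\ge 0$ be integers with $(m,n)\neq(2,0)$, and let $q\in\mathbb K^*$. Put $[k]=q^{k-1}+q^{k-3}+\cdots+q^{1-k}$ and suppose that $\ell:=\mathbf{char}(q)$, the least $k\ge 1$ with $[k]=0$, exists and satisfies $\ell\ge 3$. Let $q_i=q$ for $i\le m$ and $q_i=q^{-1}$ for $m<i\le m+n$. Let $U_q(\mathfrak{gl}(m|n))$ be the quantum general linear superalgebra with its usual generators $e_j,f_j$ $(1\le j<m+n)$, $K_i^{\pm1}$ $(1\le i\le m+n)$ and the usual relations (the Cartan relations, the quantum Serre relations, $e_m^2=f_m^2=0$ and the two quartic super Serre relations), and let $u_q(\mathfrak{gl}(m|n))$ be the small quantum superalgebra, its quotient by $E_\alpha^\ell=F_\alpha^\ell=0$ for the root vectors of all even positive roots $\alpha$ and by $K_i^{2\ell}=1$. The quantum Grassmann superalgebra $\Omega_q(m|n)=\mathcal A_q(m)\otimes\Lambda_{q^{-1}}(n)$ has the basis of monomials $x^{a}=x^{(\alpha)}\otimes x^{\mu}$, $a=\langle\alpha,\mu\rangle$,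 $\alpha\in\mathbb Z_{\ge 0}^m$, $\mu\in\{0,1\}^n$, and is a $u_q(\mathfrak{gl}(m|n))$-module by $$e_j x^{a}=[a_j+1]\,x^{a+\varepsilon_j-\varepsilon_{j+1}},\qquad f_j x^{a}=[a_{j+1}+1]\,x^{a-\varepsilon_j+\varepsilon_{j+1}},\qquad K_i^{\pm 1}x^{a}=q_i^{\pm a_i}x^{a},$$ where $x^{b}$ is read as $0$ if $b\notin\mathbb Z_{\ge 0}^m\times\{0,1\}^n$. For $s\ge 0$ let $\Omega_q^{(s)}(m|n)$ be the submodule spanned by the monomials with $\sum_i a_i=s$. Then for every integer $s\ge 0$ the $u_q(\mathfrak{gl}(m|n))$-module $M=\Omega_q^{(s)}(m|n)$ is 1. indecomposable: $M\ne0$, and $M$ is not the direct sum of two nonzero submodules; 2. rigid: $M$ has finite Loewy length $r$, and its socle and radical filtrations coincide, that is, $\mathrm{Rad}^{\,r-k}M=\mathrm{Soc}^{\,k}M$ for $0\le k\le r$. -/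

import Mathlib

namespace QGrass

/-! ## Socle series, radical series, rigidity, indecomposability -/

section ModuleTheory

/-- The socle of a module: the sum of its simple submodules. -/
def socle (R M : Type*) [Ring R] [AddCommGroup M] [Module R M] : Submodule R M :=
  sSup {N : Submodule R M | IsSimpleModule R N}

/-- The socle series: `Soc⁰ M = 0` and `Socᵏ⁺¹ M / Socᵏ M` is the socle of `M / Socᵏ M`. -/
def socSeries (R M : Type*) [Ring R] [AddCommGroup M] [Module R M] : ℕ → Submodule R M
  | 0 => ⊥
  | k + 1 => (socle R (M ⧸ socSeries R M k)).comap (socSeries R M k).mkQ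

/-- The radical series: `Rad⁰ M = M` and `Radᵏ⁺¹ M` is the radical of `Radᵏ M`, the intersection
of the maximal submodules of `Radᵏ M`. -/
def radSeries (R M : Type*) [Ring R] [AddCommGroup M] [Module R M] : ℕ → Submodule R M
  | 0 => ⊤
  | k + 1 => (Module.jacobson R (radSeries R M k)).map (radSeries R M k).subtype

/-- `r` is the Loewy length of `M` (in particular the Loewy length is finite): the least length
of a socle series that reaches `M`. -/
def IsLoewyLength (R M : Type*) [Ring R] [AddCommGroup M] [Module R M] (r : ℕ) : Prop :=
  IsLeast {k : ℕ | socSeries R M k = ⊤} r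

/-- A module is rigid if it has finite Loewy length `r` and its socle and radical filtrations
coincide: `Radʳ⁻ᵏ M = Socᵏ M` for all `k ≤ r`. -/
def IsRigid (R M : Type*) [Ring R] [AddCommGroup M] [Module R M] : Prop :=
  ∃ r : ℕ, IsLoewyLength R M r ∧ ∀ k ≤ r, radSeries R M (r - k) = socSeries R M k

/-- A module is indecomposable if it is nonzero and is not the direct sum of two nonzero
submodules. -/
def IsIndecomposable (R M : Type*) [Ring R] [AddCommGroup M] [Module R M] : Prop :=
  Nontrivial M ∧ ∀ A B : Submodule R M, IsCompl A B → A = ⊥ ∨ B = ⊥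

end ModuleTheory

/-! ## `q`-integers and the characteristic of `q` -/

section QNumbers

variable {K : Type*} [Field K]

/-- The `q`-integer `[k] = q^(k-1) + q^(k-3) + ⋯ + q^(1-k)`, the value at `q` of the Laurent
polynomial `(v^k - v^(-k)) / (v - v⁻¹)`. -/
def qInt (q : K) (k : ℕ) : K :=
  ∑ i ∈ Finset.range k, q ^ ((k : ℤ) - 1 - 2 * (i : ℤ))

/-- The characteristic of `q`: the least `k ≥ 1` with `[k] = 0`, and `0` if there is none. -/
noncomputable def qChar (q : K) : ℕ :=
  sInf {k : ℕ | 0 < k ∧ qInt q k = 0}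

end QNumbers

/-! ## The quantum superalgebras `U_q(gl(m|n))` and `u_q(gl(m|n))`

Indices start at `0`: `i : Fin (m + n)` is even if `i < m` and odd otherwise; `e_j`, `f_j` with
`j : Fin (m + n - 1)` belong to the simple root `ε_j - ε_(j+1)`, which is odd iff `j + 1 = m`. -/

section Algebra

variable {K : Type*} [Field K]

/-- The index `j` of the simple root `ε_j - ε_(j+1)`. -/
def lo {m n : ℕ} (j : Fin (m + n - 1)) : Fin (m + n) := ⟨j, by omega⟩

/-- The index `j + 1` of the simple root `ε_j - ε_(j+1)`. -/
def hi {m n : ℕ} (j : Fin (m + n - 1)) : Fin (m + n) := ⟨j + 1, by omega⟩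

/-- `q_i = q` for even `i` and `q_i = q⁻¹` for odd `i`. -/
def qi (m : ℕ) (q : K) (i : ℕ) : K := if i < m then q else q⁻¹

/-- The generators `e_j, f_j, K_i, K_i⁻¹`. -/
inductive Gen (m n : ℕ) : Type
  | e (j : Fin (m + n - 1))
  | f (j : Fin (m + n - 1))
  | k (i : Fin (m + n))
  | kinv (i : Fin (m + n))

/-- The generator `e_j` in the free algebra. -/
def fe (K : Type*) [Field K] {m n : ℕ} (j : Fin (m + n - 1)) : FreeAlgebra K (Gen m n) :=
  FreeAlgebra.ι K (Gen.e j)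

/-- The generator `f_j` in the free algebra. -/
def ff (K : Type*) [Field K] {m n : ℕ} (j : Fin (m + n - 1)) : FreeAlgebra K (Gen m n) :=
  FreeAlgebra.ι K (Gen.f j)

/-- The generator `K_i` in the free algebra. -/
def fk (K : Type*) [Field K] {m n : ℕ} (i : Fin (m + n)) : FreeAlgebra K (Gen m n) :=
  FreeAlgebra.ι K (Gen.k i)

/-- The generator `K_i⁻¹` in the free algebra. -/
def fkinv (K : Type*) [Field K] {m n : ℕ} (i : Fin (m + n)) : FreeAlgebra K (Gen m n) :=
  FreeAlgebra.ι K (Gen.kinv i)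

/-- The defining relations of `U_q(gl(m|n))`. -/
inductive URel (m n : ℕ) (q : K) :
    FreeAlgebra K (Gen m n) → FreeAlgebra K (Gen m n) → Prop
  | k_comm (i j : Fin (m + n)) : URel m n q (fk K i * fk K j) (fk K j * fk K i)
  | k_kinv (i : Fin (m + n)) : URel m n q (fk K i * fkinv K i) 1
  | kinv_k (i : Fin (m + n)) : URel m n q (fkinv K i * fk K i) 1
  | k_e (i : Fin (m + n)) (j : Fin (m + n - 1)) :
      URel m n q (fk K i * fe K j)
        (qi m q i ^ ((if i = lo j then 1 else 0) - (if i = hi j then 1 else 0) : ℤ) •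
          (fe K j * fk K i))
  | k_f (i : Fin (m + n)) (j : Fin (m + n - 1)) :
      URel m n q (fk K i * ff K j)
        (qi m q i ^ ((if i = hi j then 1 else 0) - (if i = lo j then 1 else 0) : ℤ) •
          (ff K j * fk K i))
  | e_f (i j : Fin (m + n - 1)) :
      URel m n q
        (fe K i * ff K j -
          (if (i : ℕ) + 1 = m ∧ (j : ℕ) + 1 = m then (-1 : K) else 1) • (ff K j * fe K i))
        (if i = j then
          (qi m q i - (qi m q i)⁻¹)⁻¹ •
            (fk K (lo i) * fkinv K (hi i) - fk K (hi i) * fkinv K (lo i))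
         else 0)
  | e_comm (i j : Fin (m + n - 1)) (h : (i : ℕ) + 1 < j ∨ (j : ℕ) + 1 < i) :
      URel m n q (fe K i * fe K j) (fe K j * fe K i)
  | f_comm (i j : Fin (m + n - 1)) (h : (i : ℕ) + 1 < j ∨ (j : ℕ) + 1 < i) :
      URel m n q (ff K i * ff K j) (ff K j * ff K i)
  | e_serre (i j : Fin (m + n - 1)) (h : (i : ℕ) + 1 = j ∨ (j : ℕ) + 1 = i)
      (hne : (i : ℕ) + 1 ≠ m) :
      URel m n q
        (fe K i * fe K i * fe K j - (q + q⁻¹) • (fe K i * fe K j * fe K i) +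
          fe K j * fe K i * fe K i) 0
  | f_serre (i j : Fin (m + n - 1)) (h : (i : ℕ) + 1 = j ∨ (j : ℕ) + 1 = i)
      (hne : (i : ℕ) + 1 ≠ m) :
      URel m n q
        (ff K i * ff K i * ff K j - (q + q⁻¹) • (ff K i * ff K j * ff K i) +
          ff K j * ff K i * ff K i) 0
  | e_sq (i : Fin (m + n - 1)) (hm : (i : ℕ) + 1 = m) : URel m n q (fe K i * fe K i) 0
  | f_sq (i : Fin (m + n - 1)) (hm : (i : ℕ) + 1 = m) : URel m n q (ff K i * ff K i) 0
  | e_super (a b c : Fin (m + n - 1)) (hb : (b : ℕ) + 1 = m) (ha : (a : ℕ) + 1 = b)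
      (hc : (b : ℕ) + 1 = c) :
      URel m n q
        (fe K a * fe K b * fe K c * fe K b + fe K b * fe K a * fe K b * fe K c +
          fe K c * fe K b * fe K a * fe K b + fe K b * fe K c * fe K b * fe K a -
          (q + q⁻¹) • (fe K b * fe K a * fe K c * fe K b)) 0
  | f_super (a b c : Fin (m + n - 1)) (hb : (b : ℕ) + 1 = m) (ha : (a : ℕ) + 1 = b)
      (hc : (b : ℕ) + 1 = c) :
      URel m n q
        (ff K a * ff K b * ff K c * ff K b + ff K b * ff K a * ff K b * ff K c +
          ff K c * ff K b * ff K a * ff K b + ff K b * ff K c * ff K b * ff K a -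
          (q + q⁻¹) • (ff K b * ff K a * ff K c * ff K b)) 0

/-- The quantum general linear superalgebra `U_q(gl(m|n))`. -/
def BigU (m n : ℕ) (q : K) : Type _ := RingQuot (URel m n q)

instance (m n : ℕ) (q : K) : Ring (BigU m n q) := inferInstanceAs (Ring (RingQuot (URel m n q)))

instance (m n : ℕ) (q : K) : Algebra K (BigU m n q) :=
  inferInstanceAs (Algebra K (RingQuot (URel m n q)))

/-- The class in `U_q(gl(m|n))` of an element of the free algebra. -/
def toBigU (m n : ℕ) (q : K) : FreeAlgebra K (Gen m n) →ₐ[K] BigU m n q :=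
  RingQuot.mkAlgHom K (URel m n q)

/-- The generator `e_j` of `U_q(gl(m|n))` for `j + 1 < m + n` (and `0` for other `j`). -/
def eAt (m n : ℕ) (q : K) (j : ℕ) : BigU m n q :=
  if h : j < m + n - 1 then toBigU m n q (fe K ⟨j, h⟩) else 0

/-- The generator `f_j` of `U_q(gl(m|n))` for `j + 1 < m + n` (and `0` for other `j`). -/
def fAt (m n : ℕ) (q : K) (j : ℕ) : BigU m n q :=
  if h : j < m + n - 1 then toBigU m n q (ff K ⟨j, h⟩) else 0

/-- The root vector `E_{i,i+d+1}` of the root `ε_i - ε_(i+d+1)`: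
`E_{i,i+1} = e_i` and `E_{i,b+1} = E_{i,b} e_b - q_b⁻¹ e_b E_{i,b}`. -/
def rootE (m n : ℕ) (q : K) (i : ℕ) : ℕ → BigU m n q
  | 0 => eAt m n q i
  | d + 1 => rootE m n q i d * eAt m n q (i + d + 1) -
      (qi m q (i + d + 1))⁻¹ • (eAt m n q (i + d + 1) * rootE m n q i d)

/-- The root vector `E_{i+d+1,i}` of the root `ε_(i+d+1) - ε_i`:
`E_{i+1,i} = f_i` and `E_{b+1,i} = f_b E_{b,i} - q_b E_{b,i} f_b`. -/
def rootF (m n : ℕ) (q : K) (i : ℕ) : ℕ → BigU m n q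
  | 0 => fAt m n q i
  | d + 1 => fAt m n q (i + d + 1) * rootF m n q i d -
      (qi m q (i + d + 1)) • (rootF m n q i d * fAt m n q (i + d + 1))

/-- The additional relations of the small quantum superalgebra `u_q(gl(m|n))`, with `ℓ = char(q)`:
the `ℓ`-th powers of the root vectors of all even roots vanish and `K_i^(2ℓ) = 1`. -/
inductive SmallRel (m n : ℕ) (q : K) : BigU m n q → BigU m n q → Prop
  | e_pow (i d : ℕ) (h : i + d + 1 < m ∨ (m ≤ i ∧ i + d + 1 < m + n)) :
      SmallRel m n q (rootE m n q i d ^ qChar q) 0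
  | f_pow (i d : ℕ) (h : i + d + 1 < m ∨ (m ≤ i ∧ i + d + 1 < m + n)) :
      SmallRel m n q (rootF m n q i d ^ qChar q) 0
  | k_pow (i : Fin (m + n)) :
      SmallRel m n q (toBigU m n q (fk K i) ^ (2 * qChar q)) 1

/-- The small quantum superalgebra `u_q(gl(m|n))`. -/
def SmallU (m n : ℕ) (q : K) : Type _ := RingQuot (SmallRel m n q)

instance (m n : ℕ) (q : K) : Ring (SmallU m n q) :=
  inferInstanceAs (Ring (RingQuot (SmallRel m n q)))

instance (m n : ℕ) (q : K) : Algebra K (SmallU m n q) :=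
  inferInstanceAs (Algebra K (RingQuot (SmallRel m n q)))

end Algebra

/-! ## The quantum Grassmann superalgebra and the action on it -/

section Grassmann

variable {K : Type*} [Field K]

/-- The exponents `⟨α, μ⟩` of the monomials `x^(α) ⊗ x^μ`, as `(m+n)`-tuples: the first `m` entries
are natural numbers, the last `n` entries are `0` or `1`. -/
def Expo (m n : ℕ) : Type :=
  {a : Fin (m + n) → ℕ // ∀ i : Fin (m + n), m ≤ (i : ℕ) → a i ≤ 1}

/-- The space `Ω_q(m|n) = A_q(m) ⊗ Λ_{q⁻¹}(n)`, with basis the monomials `x^(α) ⊗ x^μ`. -/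
abbrev Omega (m n : ℕ) (_q : K) : Type _ := Expo m n →₀ K

/-- The monomial with exponent `a`; it is `0` if the tuple `a` is not an admissible exponent. -/
noncomputable def mon (m n : ℕ) (q : K) (a : Fin (m + n) → ℕ) : Omega m n q :=
  open Classical in
  if h : ∀ i : Fin (m + n), m ≤ (i : ℕ) → a i ≤ 1 then Finsupp.single ⟨a, h⟩ 1 else 0

/-- The operator `x^a ↦ [a_i + 1] x^(a + ε_i - ε_j)`, where the right-hand side is `0` if
`a + ε_i - ε_j` is not an admissible exponent. -/
noncomputable def moveOp (m n : ℕ) (q : K) (i j : Fin (m + n)) : Omega m n q →ₗ[K] Omega m n q :=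
  Finsupp.lsum K fun a : Expo m n =>
    LinearMap.toSpanSingleton K (Omega m n q)
      (if a.1 j = 0 then 0
       else qInt q (a.1 i + 1) • mon m n q (a.1 - Pi.single j 1 + Pi.single i 1))

/-- The operator `x^a ↦ c^(a_i) x^a`. -/
noncomputable def diagOp (m n : ℕ) (q : K) (i : Fin (m + n)) (c : K) :
    Omega m n q →ₗ[K] Omega m n q :=
  Finsupp.lsum K fun a : Expo m n =>
    LinearMap.toSpanSingleton K (Omega m n q) (c ^ a.1 i • mon m n q a.1)

/-- The action of the generators:
`e_j x^a = [a_j + 1] x^(a + ε_j - ε_(j+1))`, `f_j x^a = [a_(j+1) + 1] x^(a - ε_j + ε_(j+1))`,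
`K_i^(±1) x^a = q_i^(±a_i) x^a`. -/
noncomputable def genAct (m n : ℕ) (q : K) : Gen m n → Module.End K (Omega m n q)
  | Gen.e j => moveOp m n q (lo j) (hi j)
  | Gen.f j => moveOp m n q (hi j) (lo j)
  | Gen.k i => diagOp m n q i (qi m q i)
  | Gen.kinv i => diagOp m n q i (qi m q i)⁻¹

end Grassmann

/-! ## The action of the generators respects the relations -/

section Action

set_option linter.unusedSimpArgs false
set_option linter.flexible false

variable {K : Type*} [Field K]

theorem qChar_spec {q : K} (h : 3 ≤ qChar q) : qInt q (qChar q) = 0 := by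
  have hne : {k : ℕ | 0 < k ∧ qInt q k = 0}.Nonempty := by
    by_contra hcon
    rw [Set.not_nonempty_iff_eq_empty] at hcon
    rw [qChar, hcon, Nat.sInf_empty] at h
    omega
  exact (Nat.sInf_mem hne).2

theorem qInt_two_ne {q : K} (h : 3 ≤ qChar q) : qInt q 2 ≠ 0 := by
  intro h2
  have : qChar q ≤ 2 := Nat.sInf_le ⟨by norm_num, h2⟩
  omega

theorem qInt_mul {q : K} (hq : q ≠ 0) (k : ℕ) :
    qInt q k * (q - q⁻¹) = q ^ (k : ℤ) - q ^ (-(k : ℤ)) := by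
  have key : ∀ c : ℤ, ∀ k : ℕ, (∑ i ∈ Finset.range k, q ^ (c - 1 - 2 * (i : ℤ))) * (q - q⁻¹)
      = q ^ c - q ^ (c - 2 * (k : ℤ)) := by
    intro c k
    induction k with
    | zero => simp
    | succ k ih =>
      rw [Finset.sum_range_succ, add_mul, ih]
      have e1 : q ^ (c - 1 - 2 * (k : ℤ)) * q = q ^ (c - 2 * (k : ℤ)) := by
        rw [← zpow_add_one₀ hq]; congr 1; ring
      have e2 : q ^ (c - 1 - 2 * (k : ℤ)) * q⁻¹ = q ^ (c - 2 * ((k + 1 : ℕ) : ℤ)) := by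
        rw [← zpow_sub_one₀ hq]; congr 1; push_cast; ring
      rw [mul_sub, e1, e2]; ring
  have := key k k
  rw [qInt, this]
  congr 2; ring

/-- The conditions on `q` that follow from `3 ≤ char(q)`. -/
theorem q_facts [CharZero K] {q : K} (h : 3 ≤ qChar q) : q ≠ 0 ∧ q - q⁻¹ ≠ 0 := by
  have h2 := qInt_two_ne h
  have hq : q ≠ 0 := by
    rintro rfl
    apply h2
    simp [qInt, Finset.sum_range_succ]
  refine ⟨hq, fun h0 => ?_⟩
  have h1 : q * q = 1 := by
    have : q = q⁻¹ := sub_eq_zero.mp h0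
    calc q * q = q * q⁻¹ := by rw [← this]
      _ = 1 := mul_inv_cancel₀ hq
  have hl := qChar_spec h
  have hz : ∀ i : ℕ, q ^ (((qChar q : ℕ) : ℤ) - 1 - 2 * (i : ℤ)) = q ^ ((qChar q : ℤ) - 1) := by
    intro i
    rw [zpow_sub₀ hq _ (2 * (i : ℤ)), zpow_mul, show (q ^ (2 : ℤ)) = 1 by
      rw [← h1]; exact zpow_two q]
    simp
  rw [qInt, Finset.sum_congr rfl (fun i _ => hz i), Finset.sum_const, Finset.card_range,
    nsmul_eq_mul] at hl
  rcases mul_eq_zero.mp hl with h3 | h3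
  · have : qChar q = 0 := by exact_mod_cast h3
    omega
  · exact zpow_ne_zero _ hq h3

theorem q_pow_two {q : K} (hq : q ≠ 0) (h : 3 ≤ qChar q) : q ^ (2 * qChar q) = 1 := by
  have := qInt_mul hq (qChar q)
  rw [qChar_spec h, zero_mul, eq_comm, sub_eq_zero, zpow_neg] at this
  rw [two_mul, pow_add]
  have h2 : q ^ qChar q ≠ 0 := pow_ne_zero _ hq
  rw [zpow_natCast] at this
  nth_rewrite 1 [this]
  exact inv_mul_cancel₀ h2

/-- `[z] = (q^z - q^(-z)) / (q - q⁻¹)` for an integer `z`. -/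
def qz (q : K) (z : ℤ) : K := (q ^ z - q ^ (-z)) / (q - q⁻¹)

theorem qInt_eq_qz {q : K} (hq : q ≠ 0) (hq1 : q - q⁻¹ ≠ 0) (k : ℕ) : qInt q k = qz q k := by
  rw [qz, eq_div_iff hq1, qInt_mul hq]

/-- The monomial with an integer exponent tuple, `0` if the tuple is not admissible. -/
noncomputable def monZ (m n : ℕ) (q : K) (b : Fin (m + n) → ℤ) : Omega m n q :=
  open Classical in
  if h : (∀ i, 0 ≤ b i) ∧ ∀ i : Fin (m + n), m ≤ (i : ℕ) → b i ≤ 1 then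
    Finsupp.single ⟨fun i => (b i).toNat, fun i hi => by have := h.2 i hi; dsimp only; omega⟩ 1
  else 0

/-- Admissible integer tuples. -/
def Adm (m n : ℕ) (b : Fin (m + n) → ℤ) : Prop :=
  ∀ i, 0 ≤ b i ∧ (m ≤ (i : ℕ) → b i ≤ 1)

theorem monZ_of_not {m n : ℕ} {q : K} {b : Fin (m + n) → ℤ} (h : ¬ Adm m n b) :
    monZ m n q b = 0 := by
  rw [monZ, dif_neg]
  rintro ⟨h1, h2⟩
  exact h fun i => ⟨h1 i, h2 i⟩

theorem monZ_coe {m n : ℕ} {q : K} (a : Expo m n) :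
    monZ m n q (fun i => (a.1 i : ℤ)) = Finsupp.single a 1 := by
  rw [monZ, dif_pos ⟨fun i => by positivity, fun i hi => by exact_mod_cast a.2 i hi⟩]
  congr 1

theorem mon_eq_monZ {m n : ℕ} {q : K} (a : Fin (m + n) → ℕ) :
    mon m n q a = monZ m n q (fun i => (a i : ℤ)) := by
  unfold mon
  split_ifs with h
  · exact (monZ_coe ⟨a, h⟩).symm
  · rw [monZ_of_not]
    intro h2
    exact h fun i hi => by
      have := (h2 i).2 hi
      dsimp only at this
      omega

theorem adm_coe {m n : ℕ} (a : Expo m n) : Adm m n (fun i => (a.1 i : ℤ)) :=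
  fun i => ⟨by positivity, fun hi => by have := a.2 i hi; dsimp only; omega⟩

theorem exists_coe {m n : ℕ} {b : Fin (m + n) → ℤ} (h : Adm m n b) :
    ∃ a : Expo m n, b = fun i => (a.1 i : ℤ) :=
  ⟨⟨fun i => (b i).toNat, fun i hi => by have := (h i).2 hi; dsimp only; omega⟩,
    funext fun i => by have := (h i).1; simp [this]⟩

theorem end_ext {m n : ℕ} {q : K} {S T : Module.End K (Omega m n q)}
    (h : ∀ b, Adm m n b → S (monZ m n q b) = T (monZ m n q b)) : S = T := by
  refine Finsupp.lhom_ext' fun a => LinearMap.ext_ring ?_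
  have := h _ (adm_coe a)
  rw [monZ_coe] at this
  simpa using this

/-- The tuple `ε_i`. -/
def eps {N : ℕ} (i : Fin N) : Fin N → ℤ := Pi.single i 1

/-- The scalar of the action of a move on a monomial. -/
noncomputable def coefZ (m : ℕ) (q : K) (j : ℕ) (A B : ℤ) : K :=
  if m ≤ j ∧ 2 ≤ B then 0 else qz q (A + 1)

theorem qz_zero (q : K) : qz q 0 = 0 := by simp [qz]

theorem moveOp_monZ {m n : ℕ} {q : K} (hq : q ≠ 0) (hq1 : q - q⁻¹ ≠ 0) {i j : Fin (m + n)}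
    (hij : i ≠ j) (b : Fin (m + n) → ℤ) :
    moveOp m n q i j (monZ m n q b) =
      coefZ m q j (b i) (b j) • monZ m n q (b + eps i - eps j) := by
  by_cases hb : Adm m n b
  · obtain ⟨a, rfl⟩ := exists_coe hb
    rw [monZ_coe]
    have hB : ¬ (m ≤ (j : ℕ) ∧ (2 : ℤ) ≤ (a.1 j : ℤ)) := by
      rintro ⟨h1, h2⟩
      have := a.2 j h1
      omega
    simp only [coefZ, if_neg hB, moveOp, Finsupp.lsum_single, LinearMap.toSpanSingleton_apply,
      one_smul]
    split_ifs with h0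
    · rw [monZ_of_not, smul_zero]
      intro h
      have := (h j).1
      simp [eps, h0, hij.symm] at this
    · rw [qInt_eq_qz hq hq1, mon_eq_monZ]
      push_cast
      congr 2
      funext k
      simp only [eps, Pi.add_apply, Pi.sub_apply, Pi.single_apply]
      split_ifs <;> subst_vars <;> simp_all <;> omega
  · rw [monZ_of_not hb, map_zero]
    by_cases hc : Adm m n (b + eps i - eps j)
    · have hi : ∀ k, k ≠ i → k ≠ j → 0 ≤ b k ∧ (m ≤ (k : ℕ) → b k ≤ 1) := by
        intro k h1 h2
        simpa [eps, h1, h2] using hc k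
      have h1 := hc i
      have h2 := hc j
      simp only [eps, Pi.add_apply, Pi.sub_apply, Pi.single_eq_same, Pi.single_eq_of_ne hij,
        Pi.single_eq_of_ne hij.symm] at h1 h2
      rw [coefZ]
      split_ifs with h3
      · simp
      · by_cases h4 : b i = -1
        · simp [h4, qz_zero]
        · exfalso
          apply hb
          intro k
          by_cases hki : k = i
          · subst hki
            exact ⟨by omega, fun h => by have := h1.2 h; omega⟩
          · by_cases hkj : k = j
            · subst hkj
              refine ⟨by omega, fun h => ?_⟩
              by_contra h5
              exact h3 ⟨h, by omega⟩
            · exact hi k hki hkj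
    · rw [monZ_of_not hc, smul_zero]

theorem diagOp_monZ {m n : ℕ} {q : K} (i : Fin (m + n)) {c : K}
    (b : Fin (m + n) → ℤ) :
    diagOp m n q i c (monZ m n q b) = c ^ (b i) • monZ m n q b := by
  by_cases hb : Adm m n b
  · obtain ⟨a, rfl⟩ := exists_coe hb
    rw [monZ_coe]
    simp only [diagOp, Finsupp.lsum_single, LinearMap.toSpanSingleton_apply, one_smul,
      zpow_natCast]
    rw [mon_eq_monZ, monZ_coe]
  · simp [monZ_of_not hb]

theorem move_comm {m n : ℕ} {q : K} (hq : q ≠ 0) (hq1 : q - q⁻¹ ≠ 0) {i j k l : Fin (m + n)}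
    (hij : i ≠ j) (hkl : k ≠ l) (hil : i ≠ l) (hjk : j ≠ k) :
    moveOp m n q i j * moveOp m n q k l = moveOp m n q k l * moveOp m n q i j := by
  refine end_ext fun b hb => ?_
  simp only [Module.End.mul_apply, moveOp_monZ hq hq1 hij, moveOp_monZ hq hq1 hkl, map_smul,
    smul_smul]
  rw [show b + eps k - eps l + eps i - eps j = b + eps i - eps j + eps k - eps l by abel]
  by_cases hc : Adm m n (b + eps i - eps j + eps k - eps l)
  · congr 1
    have h1 := hb j
    have h2 := hb l
    by_cases hik : i = k
    · subst hik
      by_cases hjl : j = l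
      · subst hjl; rfl
      · simp [coefZ, eps, hij, hil, hij.symm, hil.symm, hjl, Ne.symm hjl]
        split_ifs <;> rfl
    · by_cases hjl : j = l
      · subst hjl
        simp [coefZ, eps, hij, hil, hij.symm, hil.symm, hkl, hkl.symm, hik, Ne.symm hik]
        split_ifs <;> first | rfl | ring
      · simp [coefZ, eps, hij, hil, hij.symm, hil.symm, hkl, hkl.symm, hik, Ne.symm hik, hjl,
          Ne.symm hjl, hjk, hjk.symm]
        split_ifs <;> first | rfl | ring
  · simp [monZ_of_not hc]

theorem qz_one {q : K} (hq1 : q - q⁻¹ ≠ 0) : qz q 1 = 1 := by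
  simp only [qz, zpow_one, zpow_neg]
  exact div_self hq1

theorem qz_serre {q : K} (hq : q ≠ 0) (A : ℤ) :
    qz q (A + 1) - (q + q⁻¹) * qz q A + qz q (A - 1) = 0 := by
  have h : q ^ A ≠ 0 := zpow_ne_zero _ hq
  rw [qz, qz, qz, mul_div_assoc', ← sub_div, ← add_div, div_eq_zero_iff]
  left
  simp only [zpow_neg, zpow_add₀ hq, zpow_sub₀ hq, zpow_one]
  field_simp
  ring

theorem qz_bracket {q : K} (hq : q ≠ 0) (hq1 : q - q⁻¹ ≠ 0) (A B : ℤ) :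
    qz q A * qz q (B + 1) - qz q (A + 1) * qz q B =
      (q - q⁻¹)⁻¹ * (q ^ A * q⁻¹ ^ B - q ^ B * q⁻¹ ^ A) := by
  have hA : q ^ A ≠ 0 := zpow_ne_zero _ hq
  have hB : q ^ B ≠ 0 := zpow_ne_zero _ hq
  have h2 : q ^ 2 - 1 ≠ 0 := by
    intro h
    apply hq1
    field_simp
    linear_combination h
  simp only [qz, zpow_neg, zpow_add₀ hq, zpow_one, inv_zpow]
  field_simp
  ring

theorem move_bracket {m n : ℕ} {q : K} (hq : q ≠ 0) (hq1 : q - q⁻¹ ≠ 0) {i j : Fin (m + n)}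
    (hij : i < j) :
    moveOp m n q i j * moveOp m n q j i -
      (if (i : ℕ) < m ∧ m ≤ (j : ℕ) then (-1 : K) else 1) •
        (moveOp m n q j i * moveOp m n q i j) =
    (qi m q i - (qi m q i)⁻¹)⁻¹ •
      (diagOp m n q i (qi m q i) * diagOp m n q j (qi m q j)⁻¹ -
        diagOp m n q j (qi m q j) * diagOp m n q i (qi m q i)⁻¹) := by
  have hne : i ≠ j := ne_of_lt hij
  have hlt : (i : ℕ) < j := hij
  have hq2 : 1 - q ^ 2 ≠ 0 := by
    intro h
    apply hq1
    field_simp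
    linear_combination -h
  refine end_ext fun b hb => ?_
  simp only [Module.End.mul_apply, LinearMap.sub_apply, LinearMap.smul_apply,
    moveOp_monZ hq hq1 hne, moveOp_monZ hq hq1 hne.symm, diagOp_monZ, map_smul, smul_smul]
  rw [show b + eps j - eps i + eps i - eps j = b by abel,
    show b + eps i - eps j + eps j - eps i = b by abel, ← sub_smul, ← sub_smul, smul_smul]
  congr 1
  have h1 := hb i
  have h2 := hb j
  generalize hA : b i = A at h1 ⊢
  generalize hB : b j = B at h2 ⊢
  simp only [coefZ, eps, Pi.add_apply, Pi.sub_apply, Pi.single_eq_same, Pi.single_eq_of_ne hne,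
    Pi.single_eq_of_ne hne.symm, hA, hB, qi]
  have hk := qz_bracket hq hq1 A B
  by_cases hj : (j : ℕ) < m
  · have hi : (i : ℕ) < m := by omega
    simp only [hi, hj, not_le.mpr hi, not_le.mpr hj, if_true, if_false, false_and, and_false]
    simp only [add_zero, sub_add_cancel, one_mul]
    linear_combination hk
  · have hj' : m ≤ (j : ℕ) := by omega
    have hinv : q⁻¹ - q ≠ 0 := fun h => hq1 (by linear_combination -h)
    have hBc : B = 0 ∨ B = 1 := by have := h2.2 hj'; omega
    by_cases hi : (i : ℕ) < m
    · have hA0 : q ^ A ≠ 0 := zpow_ne_zero _ hq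
      rcases hBc with rfl | rfl
      · simp [hi, hj, hj', not_le.mpr hi, qz_zero, qz_one hq1]
        rw [qz, zpow_neg]; ring
      · simp [hi, hj, hj', not_le.mpr hi, qz_zero, qz_one hq1]
        rw [qz, zpow_neg, zpow_add_one₀ hq, mul_inv]; ring
    · have hi' : m ≤ (i : ℕ) := by omega
      have hAc : A = 0 ∨ A = 1 := by have := h1.2 hi'; omega
      rcases hAc with rfl | rfl <;> rcases hBc with rfl | rfl <;>
        simp [hi, hj, hi', hj', qz_zero, qz_one hq1]
      · rw [eq_inv_mul_iff_mul_eq₀ hinv]; ring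
      · rw [inv_mul_cancel₀ hinv]

theorem move_serre₁ {m n : ℕ} {q : K} (hq : q ≠ 0) (hq1 : q - q⁻¹ ≠ 0) {i j k : Fin (m + n)}
    (hij : i ≠ j) (hjk : j ≠ k) (hik : i ≠ k) (hpar : (i : ℕ) < m ↔ (j : ℕ) < m) :
    moveOp m n q i j * moveOp m n q i j * moveOp m n q j k -
      (q + q⁻¹) • (moveOp m n q i j * moveOp m n q j k * moveOp m n q i j) +
      moveOp m n q j k * moveOp m n q i j * moveOp m n q i j = 0 := by
  refine end_ext fun b hb => ?_
  simp only [Module.End.mul_apply, LinearMap.sub_apply, LinearMap.add_apply, LinearMap.smul_apply,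
    moveOp_monZ hq hq1 hij, moveOp_monZ hq hq1 hjk, map_smul, smul_smul, LinearMap.zero_apply]
  rw [show b + eps j - eps k + eps i - eps j + eps i - eps j
      = b + eps i - eps j + eps i - eps k by abel,
    show b + eps i - eps j + eps j - eps k + eps i - eps j
      = b + eps i - eps j + eps i - eps k by abel,
    show b + eps i - eps j + eps i - eps j + eps j - eps k
      = b + eps i - eps j + eps i - eps k by abel, ← sub_smul, ← add_smul]
  by_cases hc : Adm m n (b + eps i - eps j + eps i - eps k)
  · convert zero_smul K _
    have h1 := hb i
    have h2 := hb k
    have h3 := hc i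
    simp [eps, hij, hij.symm, hik, hik.symm] at h3
    have hi : (i : ℕ) < m := by by_contra h; have := h3.2 (by omega); omega
    have hj := hpar.mp hi
    simp [coefZ, eps, hij, hij.symm, hik, hik.symm, hjk, hjk.symm, not_le.mpr hi, not_le.mpr hj]
    have hs := qz_serre hq (b j)
    split_ifs
    · ring
    · linear_combination qz q (b i + 1) * qz q (b i + 1 + 1) * hs
  · simp [monZ_of_not hc]

theorem move_serre₂ {m n : ℕ} {q : K} (hq : q ≠ 0) (hq1 : q - q⁻¹ ≠ 0) {i j k : Fin (m + n)}
    (hij : i ≠ j) (hjk : j ≠ k) (hik : i ≠ k) (hpar : (i : ℕ) < m ↔ (j : ℕ) < m) :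
    moveOp m n q i j * moveOp m n q i j * moveOp m n q k i -
      (q + q⁻¹) • (moveOp m n q i j * moveOp m n q k i * moveOp m n q i j) +
      moveOp m n q k i * moveOp m n q i j * moveOp m n q i j = 0 := by
  refine end_ext fun b hb => ?_
  simp only [Module.End.mul_apply, LinearMap.sub_apply, LinearMap.add_apply, LinearMap.smul_apply,
    moveOp_monZ hq hq1 hij, moveOp_monZ hq hq1 hik.symm, map_smul, smul_smul,
    LinearMap.zero_apply]
  rw [show b + eps k - eps i + eps i - eps j + eps i - eps j
      = b + eps i - eps j - eps j + eps k by abel,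
    show b + eps i - eps j + eps k - eps i + eps i - eps j
      = b + eps i - eps j - eps j + eps k by abel,
    show b + eps i - eps j + eps i - eps j + eps k - eps i
      = b + eps i - eps j - eps j + eps k by abel, ← sub_smul, ← add_smul]
  by_cases hc : Adm m n (b + eps i - eps j - eps j + eps k)
  · convert zero_smul K _
    have h1 := hb j
    have h3 := hc j
    simp [eps, hij, hij.symm, hjk, hjk.symm] at h3
    have hj : (j : ℕ) < m := by by_contra h; have := h1.2 (by omega); omega
    have hi := hpar.mpr hj
    simp [coefZ, eps, hij, hij.symm, hik, hik.symm, hjk, hjk.symm, not_le.mpr hi, not_le.mpr hj]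
    have hs := qz_serre hq (b i + 1)
    rw [add_sub_cancel_right] at hs
    linear_combination qz q (b k + 1) * qz q (b i + 1) * hs
  · simp [monZ_of_not hc]

theorem move_sq {m n : ℕ} {q : K} (hq : q ≠ 0) (hq1 : q - q⁻¹ ≠ 0) {i j : Fin (m + n)}
    (hij : i ≠ j) (hodd : m ≤ (i : ℕ) ∨ m ≤ (j : ℕ)) :
    moveOp m n q i j * moveOp m n q i j = 0 := by
  refine end_ext fun b hb => ?_
  simp only [Module.End.mul_apply, moveOp_monZ hq hq1 hij, map_smul, smul_smul,
    LinearMap.zero_apply]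
  rw [monZ_of_not, smul_zero]
  intro hc
  have h1 := hb i
  have h2 := hb j
  have h3 := hc i
  have h4 := hc j
  simp [eps, hij, hij.symm] at h3 h4
  rcases hodd with h | h
  · have := h3.2 h; omega
  · have := h2.2 h; omega

theorem move_super_e {m n : ℕ} {q : K} (hq : q ≠ 0) (hq1 : q - q⁻¹ ≠ 0) {i j k l : Fin (m + n)}
    (hij : i < j) (hjk : j < k) (hkl : k < l) (hj : (j : ℕ) < m) (hk : m ≤ (k : ℕ)) :
    moveOp m n q i j * moveOp m n q j k * moveOp m n q k l * moveOp m n q j k +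
      moveOp m n q j k * moveOp m n q i j * moveOp m n q j k * moveOp m n q k l +
      moveOp m n q k l * moveOp m n q j k * moveOp m n q i j * moveOp m n q j k +
      moveOp m n q j k * moveOp m n q k l * moveOp m n q j k * moveOp m n q i j -
      (q + q⁻¹) • (moveOp m n q j k * moveOp m n q i j * moveOp m n q k l * moveOp m n q j k) =
    0 := by
  have e1 := hij.ne
  have e2 := hjk.ne
  have e3 := hkl.ne
  have e4 := (hij.trans hjk).ne
  have e5 := (hjk.trans hkl).ne
  have e6 := (hij.trans (hjk.trans hkl)).ne
  have hi : (i : ℕ) < m := lt_trans hij hj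
  have hl : m ≤ (l : ℕ) := hk.trans (le_of_lt hkl)
  refine end_ext fun b hb => ?_
  simp only [Module.End.mul_apply, LinearMap.sub_apply, LinearMap.add_apply, LinearMap.smul_apply,
    moveOp_monZ hq hq1 e1, moveOp_monZ hq hq1 e2, moveOp_monZ hq hq1 e3, map_smul, smul_smul,
    LinearMap.zero_apply]
  rw [show b + eps j - eps k + eps k - eps l + eps j - eps k + eps i - eps j
      = b + eps j - eps k - eps l + eps i by abel,
    show b + eps k - eps l + eps j - eps k + eps i - eps j + eps j - eps k
      = b + eps j - eps k - eps l + eps i by abel,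
    show b + eps j - eps k + eps i - eps j + eps j - eps k + eps k - eps l
      = b + eps j - eps k - eps l + eps i by abel,
    show b + eps i - eps j + eps j - eps k + eps k - eps l + eps j - eps k
      = b + eps j - eps k - eps l + eps i by abel,
    show b + eps j - eps k + eps k - eps l + eps i - eps j + eps j - eps k
      = b + eps j - eps k - eps l + eps i by abel, ← add_smul, ← add_smul, ← add_smul, ← sub_smul]
  by_cases hc : Adm m n (b + eps j - eps k - eps l + eps i)
  · convert zero_smul K _
    have h1 := (hb k).2 hk
    have h2 := (hb l).2 hl
    have h3 := (hc k).1
    have h4 := (hc l).1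
    simp [eps, e1, e2, e3, e4, e5, e6, e1.symm, e2.symm, e3.symm, e4.symm, e5.symm,
      e6.symm] at h3 h4
    have hbk : b k = 1 := by omega
    have hbl : b l = 1 := by omega
    simp [coefZ, eps, e1, e2, e3, e4, e5, e6, e1.symm, e2.symm, e3.symm, e4.symm, e5.symm,
      e6.symm, not_le.mpr hj, hk, hl, hbk, hbl, qz_one hq1, qz_zero]
    have hs := qz_serre hq (b j + 1)
    rw [add_sub_cancel_right] at hs
    linear_combination qz q (b i + 1) * qz q (b j + 1) * hs
  · simp [monZ_of_not hc]

theorem move_super_f {m n : ℕ} {q : K} (hq : q ≠ 0) (hq1 : q - q⁻¹ ≠ 0) {i j k l : Fin (m + n)}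
    (hij : i < j) (hjk : j < k) (hkl : k < l) (hj : (j : ℕ) < m) (hk : m ≤ (k : ℕ)) :
    moveOp m n q j i * moveOp m n q k j * moveOp m n q l k * moveOp m n q k j +
      moveOp m n q k j * moveOp m n q j i * moveOp m n q k j * moveOp m n q l k +
      moveOp m n q l k * moveOp m n q k j * moveOp m n q j i * moveOp m n q k j +
      moveOp m n q k j * moveOp m n q l k * moveOp m n q k j * moveOp m n q j i -
      (q + q⁻¹) • (moveOp m n q k j * moveOp m n q j i * moveOp m n q l k * moveOp m n q k j) =
    0 := by
  have e1 := hij.ne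
  have e2 := hjk.ne
  have e3 := hkl.ne
  have e4 := (hij.trans hjk).ne
  have e5 := (hjk.trans hkl).ne
  have e6 := (hij.trans (hjk.trans hkl)).ne
  have hi : (i : ℕ) < m := lt_trans hij hj
  have hl : m ≤ (l : ℕ) := hk.trans (le_of_lt hkl)
  refine end_ext fun b hb => ?_
  simp only [Module.End.mul_apply, LinearMap.sub_apply, LinearMap.add_apply, LinearMap.smul_apply,
    moveOp_monZ hq hq1 e1.symm, moveOp_monZ hq hq1 e2.symm, moveOp_monZ hq hq1 e3.symm, map_smul,
    smul_smul, LinearMap.zero_apply]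
  rw [show b + eps k - eps j + eps l - eps k + eps k - eps j + eps j - eps i
      = b - eps j + eps k + eps l - eps i by abel,
    show b + eps l - eps k + eps k - eps j + eps j - eps i + eps k - eps j
      = b - eps j + eps k + eps l - eps i by abel,
    show b + eps k - eps j + eps j - eps i + eps k - eps j + eps l - eps k
      = b - eps j + eps k + eps l - eps i by abel,
    show b + eps j - eps i + eps k - eps j + eps l - eps k + eps k - eps j
      = b - eps j + eps k + eps l - eps i by abel,
    show b + eps k - eps j + eps l - eps k + eps j - eps i + eps k - eps j
      = b - eps j + eps k + eps l - eps i by abel, ← add_smul, ← add_smul, ← add_smul, ← sub_smul]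
  by_cases hc : Adm m n (b - eps j + eps k + eps l - eps i)
  · convert zero_smul K _
    have h1 := (hb k).1
    have h2 := (hb l).1
    have h3 := (hc k).2 hk
    have h4 := (hc l).2 hl
    simp [eps, e1, e2, e3, e4, e5, e6, e1.symm, e2.symm, e3.symm, e4.symm, e5.symm,
      e6.symm] at h3 h4
    have hbk : b k = 0 := by omega
    have hbl : b l = 0 := by omega
    simp [coefZ, eps, e1, e2, e3, e4, e5, e6, e1.symm, e2.symm, e3.symm, e4.symm, e5.symm,
      e6.symm, not_le.mpr hj, not_le.mpr hi, hk, hl, hbk, hbl, qz_one hq1, qz_zero]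
    linear_combination qz_serre hq (b j)
  · simp [monZ_of_not hc]

/-- `T` maps each monomial `x^b` to a multiple of `[b_p + 1] x^(b + ε_p - ε_r)`. -/
def IsMove {m n : ℕ} {q : K} (T : Module.End K (Omega m n q)) (p r : Fin (m + n)) : Prop :=
  ∀ b : Fin (m + n) → ℤ, ∃ g : K,
    T (monZ m n q b) = (g * qz q (b p + 1)) • monZ m n q (b + eps p - eps r)

theorem isMove_moveOp {m n : ℕ} {q : K} (hq : q ≠ 0) (hq1 : q - q⁻¹ ≠ 0) {i j : Fin (m + n)}
    (hij : i ≠ j) : IsMove (moveOp m n q i j) i j := by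
  intro b
  rw [moveOp_monZ hq hq1 hij, coefZ]
  split_ifs
  · exact ⟨0, by simp⟩
  · exact ⟨1, by simp⟩

theorem isMove_smul {m n : ℕ} {q : K} {T : Module.End K (Omega m n q)} {p r : Fin (m + n)}
    (hT : IsMove T p r) (c : K) : IsMove (c • T) p r := by
  intro b
  obtain ⟨g, hg⟩ := hT b
  exact ⟨c * g, by rw [LinearMap.smul_apply, hg, smul_smul, mul_assoc]⟩

theorem isMove_sub {m n : ℕ} {q : K} {S T : Module.End K (Omega m n q)} {p r : Fin (m + n)}
    (hS : IsMove S p r) (hT : IsMove T p r) : IsMove (S - T) p r := by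
  intro b
  obtain ⟨g, hg⟩ := hS b
  obtain ⟨g', hg'⟩ := hT b
  exact ⟨g - g', by rw [LinearMap.sub_apply, hg, hg', ← sub_smul, sub_mul]⟩

theorem isMove_mul₁ {m n : ℕ} {q : K} {S T : Module.End K (Omega m n q)}
    {p r s : Fin (m + n)} (hpr : p ≠ r) (hps : p ≠ s) (hS : IsMove S p r) (hT : IsMove T r s) :
    IsMove (S * T) p s := by
  intro b
  obtain ⟨g, hg⟩ := hT b
  obtain ⟨g', hg'⟩ := hS (b + eps r - eps s)
  refine ⟨g * qz q (b r + 1) * g', ?_⟩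
  rw [Module.End.mul_apply, hg, map_smul, hg', smul_smul]
  congr 1
  · simp [eps, hpr, hps]; ring
  · congr 1; abel

theorem isMove_mul₂ {m n : ℕ} {q : K} {S T : Module.End K (Omega m n q)}
    {p r s : Fin (m + n)} (hS : IsMove S p r) (hT : IsMove T r s) :
    IsMove (T * S) p s := by
  intro b
  obtain ⟨g, hg⟩ := hS b
  obtain ⟨g', hg'⟩ := hT (b + eps p - eps r)
  refine ⟨g * (g' * qz q ((b + eps p - eps r) r + 1)), ?_⟩
  rw [Module.End.mul_apply, hg, map_smul, hg', smul_smul]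
  congr 1
  · ring
  · congr 1; abel

theorem qz_mul_char {q : K} (hq : q ≠ 0) (h : 3 ≤ qChar q) (t : ℤ) :
    qz q (qChar q * t) = 0 := by
  have h2 : q ^ ((qChar q : ℤ) * t) = q ^ (-((qChar q : ℤ) * t)) := by
    have : q ^ ((qChar q : ℤ) * t) * q ^ ((qChar q : ℤ) * t) = 1 := by
      rw [← zpow_add₀ hq, ← two_mul, ← mul_assoc, zpow_mul]
      have h3 : q ^ (2 * (qChar q : ℤ)) = 1 := by exact_mod_cast q_pow_two hq h
      rw [h3, one_zpow]
    rw [zpow_neg]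
    exact eq_inv_of_mul_eq_one_left this
  rw [qz, h2, sub_self, zero_div]

theorem isMove_pow {m n : ℕ} {q : K} (hq : q ≠ 0) (h : 3 ≤ qChar q)
    {T : Module.End K (Omega m n q)} {p r : Fin (m + n)} (hpr : p ≠ r) (hT : IsMove T p r) :
    T ^ qChar q = 0 := by
  have key : ∀ k : ℕ, ∀ b : Fin (m + n) → ℤ, ∃ g : K,
      (T ^ k) (monZ m n q b) = (g * ∏ t ∈ Finset.range k, qz q (b p + t + 1)) •
        monZ m n q (b + (k : ℤ) • eps p - (k : ℤ) • eps r) := by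
    intro k
    induction k with
    | zero => intro b; exact ⟨1, by simp⟩
    | succ k ih =>
      intro b
      obtain ⟨g, hg⟩ := ih b
      obtain ⟨g', hg'⟩ := hT (b + (k : ℤ) • eps p - (k : ℤ) • eps r)
      refine ⟨g * g', ?_⟩
      rw [pow_succ', Module.End.mul_apply, hg, map_smul, hg', smul_smul, Finset.prod_range_succ]
      congr 1
      · simp [eps, hpr]; ring
      · congr 1
        push_cast
        rw [add_smul, add_smul, one_smul, one_smul]
        abel
  refine end_ext fun b _ => ?_
  obtain ⟨g, hg⟩ := key (qChar q) b
  rw [hg, LinearMap.zero_apply]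
  have hl : (0 : ℤ) < qChar q := by exact_mod_cast (by omega : 0 < qChar q)
  set t : ℤ := (-(b p + 1)) % qChar q with ht
  have ht0 : 0 ≤ t := Int.emod_nonneg _ hl.ne'
  have htl : t < qChar q := Int.emod_lt_of_pos _ hl
  have hz : qz q (b p + t.toNat + 1) = 0 := by
    have hd := Int.mul_ediv_add_emod (-(b p + 1)) (qChar q)
    rw [← qz_mul_char hq h (-(-(b p + 1) / (qChar q : ℤ)))]
    congr 1
    rw [Int.toNat_of_nonneg ht0, ht]
    linear_combination hd
  rw [Finset.prod_eq_zero (i := t.toNat) (by rw [Finset.mem_range]; omega) hz, mul_zero, zero_smul]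

theorem lo_lt_hi {m n : ℕ} (j : Fin (m + n - 1)) : lo j < hi j :=
  Fin.mk_lt_mk.mpr (Nat.lt_succ_self _)

theorem fin_ne {N : ℕ} {i j : Fin N} (h : (i : ℕ) ≠ j) : i ≠ j := fun e => h (congrArg _ e)

theorem diag_move {m n : ℕ} {q c : K} (hq : q ≠ 0) (hq1 : q - q⁻¹ ≠ 0) (hc : c ≠ 0)
    {i j : Fin (m + n)} (hij : i ≠ j) (k : Fin (m + n)) :
    diagOp m n q k c * moveOp m n q i j =
      c ^ ((if k = i then 1 else 0) - (if k = j then 1 else 0) : ℤ) •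
        (moveOp m n q i j * diagOp m n q k c) := by
  refine end_ext fun b _ => ?_
  simp only [Module.End.mul_apply, LinearMap.smul_apply, moveOp_monZ hq hq1 hij, diagOp_monZ,
    map_smul, smul_smul]
  congr 1
  rw [← mul_assoc, ← zpow_add₀ hc, mul_comm]
  congr 2
  simp only [eps, Pi.add_apply, Pi.sub_apply, Pi.single_apply]
  split_ifs <;> ring

theorem qi_ne {q : K} (hq : q ≠ 0) (m i : ℕ) : qi m q i ≠ 0 := by
  unfold qi
  split_ifs
  · exact hq
  · exact inv_ne_zero hq

theorem diag_inv {m n : ℕ} {q c d : K} (hcd : c * d = 1) (i : Fin (m + n)) :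
    diagOp m n q i c * diagOp m n q i d = 1 := by
  refine end_ext fun b _ => ?_
  simp only [Module.End.mul_apply, diagOp_monZ, map_smul, smul_smul, Module.End.one_apply]
  rw [← mul_zpow, mul_comm d c, hcd, one_zpow, one_smul]

theorem diag_pow {m n : ℕ} {q c : K} (i : Fin (m + n)) {k : ℕ} (hc : c ^ k = 1) :
    diagOp m n q i c ^ k = 1 := by
  refine end_ext fun b _ => ?_
  have key : ∀ t : ℕ, (diagOp m n q i c ^ t) (monZ m n q b) = (c ^ b i) ^ t • monZ m n q b := by
    intro t
    induction t with
    | zero => simp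
    | succ t ih =>
      rw [pow_succ, Module.End.mul_apply, diagOp_monZ, map_smul, ih, smul_smul, pow_succ, mul_comm]
  rw [key, Module.End.one_apply, ← zpow_natCast, ← zpow_mul, mul_comm, zpow_mul, zpow_natCast, hc,
    one_zpow, one_smul]

theorem diag_comm {m n : ℕ} {q c d : K} (i j : Fin (m + n)) :
    diagOp m n q i c * diagOp m n q j d = diagOp m n q j d * diagOp m n q i c := by
  refine end_ext fun b _ => ?_
  simp only [Module.End.mul_apply, diagOp_monZ, map_smul, smul_smul]
  rw [mul_comm]

/-- The action of the generators satisfies the relations of `U_q(gl(m|n))`. -/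
theorem genAct_rel {m n : ℕ} {q : K} (hq : q ≠ 0) (hq1 : q - q⁻¹ ≠ 0)
    {x y : FreeAlgebra K (Gen m n)} (hxy : URel m n q x y) :
    FreeAlgebra.lift K (genAct m n q) x = FreeAlgebra.lift K (genAct m n q) y := by
  induction hxy with
  | k_comm i j => simpa [fk, genAct] using diag_comm i j
  | k_kinv i =>
    simpa [fk, fkinv, genAct] using diag_inv (mul_inv_cancel₀ (qi_ne hq m i)) i
  | kinv_k i =>
    simpa [fk, fkinv, genAct] using diag_inv (inv_mul_cancel₀ (qi_ne hq m i)) i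
  | k_e i j =>
    simpa only [fk, fe, genAct, map_mul, map_smul, FreeAlgebra.lift_ι_apply] using
      diag_move hq hq1 (qi_ne hq m i) (lo_lt_hi j).ne i
  | k_f i j =>
    simpa only [fk, ff, genAct, map_mul, map_smul, FreeAlgebra.lift_ι_apply] using
      diag_move hq hq1 (qi_ne hq m i) (lo_lt_hi j).ne' i
  | e_f i j =>
    by_cases hij : i = j
    · subst hij
      rw [if_pos rfl]
      simp only [fk, fkinv, fe, ff, genAct, map_mul, map_sub, map_smul, FreeAlgebra.lift_ι_apply,
        and_self]
      have hb := move_bracket hq hq1 (lo_lt_hi i)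
      have hs : (if (i : ℕ) + 1 = m then (-1 : K) else 1) =
          if ((lo i : Fin (m + n)) : ℕ) < m ∧ m ≤ ((hi i : Fin (m + n)) : ℕ) then -1 else 1 :=
        if_congr (by simp only [lo, hi]; omega) rfl rfl
      rw [hs]
      exact hb
    · rw [if_neg hij, if_neg (by rintro ⟨h1, h2⟩; exact hij (Fin.ext (by omega))), one_smul]
      simp only [fe, ff, genAct, map_mul, map_sub, FreeAlgebra.lift_ι_apply, map_zero]
      have hij' : (i : ℕ) ≠ j := fun h => hij (Fin.ext h)
      rw [sub_eq_zero]
      exact move_comm hq hq1 (lo_lt_hi i).ne (lo_lt_hi j).ne' (fin_ne (by simpa [lo] using hij'))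
        (fin_ne (by simpa [hi] using hij'))
  | e_comm i j h =>
    simp only [fe, genAct, map_mul, FreeAlgebra.lift_ι_apply]
    exact move_comm hq hq1 (lo_lt_hi i).ne (lo_lt_hi j).ne (fin_ne (by simp only [lo, hi]; omega))
      (fin_ne (by simp only [lo, hi]; omega))
  | f_comm i j h =>
    simp only [ff, genAct, map_mul, FreeAlgebra.lift_ι_apply]
    exact move_comm hq hq1 (lo_lt_hi i).ne' (lo_lt_hi j).ne' (fin_ne (by simp only [lo, hi]; omega))
      (fin_ne (by simp only [lo, hi]; omega))
  | e_serre i j h hne =>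
    simp only [fe, genAct, map_mul, map_sub, map_add, map_smul, map_zero,
      FreeAlgebra.lift_ι_apply]
    rcases h with h | h
    · rw [show lo j = hi i from Fin.ext (by simp only [lo, hi]; omega)]
      exact move_serre₁ hq hq1 (lo_lt_hi i).ne (fin_ne (by simp only [hi]; omega))
        (fin_ne (by simp only [lo, hi]; omega)) (by simp only [lo, hi]; omega)
    · rw [show hi j = lo i from Fin.ext (by simp only [lo, hi]; omega)]
      exact move_serre₂ hq hq1 (lo_lt_hi i).ne (fin_ne (by simp only [lo, hi]; omega))
        (fin_ne (by simp only [lo]; omega)) (by simp only [lo, hi]; omega)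
  | f_serre i j h hne =>
    simp only [ff, genAct, map_mul, map_sub, map_add, map_smul, map_zero,
      FreeAlgebra.lift_ι_apply]
    rcases h with h | h
    · rw [show lo j = hi i from Fin.ext (by simp only [lo, hi]; omega)]
      exact move_serre₂ hq hq1 (lo_lt_hi i).ne' (fin_ne (by simp only [lo, hi]; omega))
        (fin_ne (by simp only [hi]; omega)) (by simp only [lo, hi]; omega)
    · rw [show hi j = lo i from Fin.ext (by simp only [lo, hi]; omega)]
      exact move_serre₁ hq hq1 (lo_lt_hi i).ne' (fin_ne (by simp only [lo]; omega))
        (fin_ne (by simp only [lo, hi]; omega)) (by simp only [lo, hi]; omega)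
  | e_sq i hm =>
    simp only [fe, genAct, map_mul, map_zero, FreeAlgebra.lift_ι_apply]
    exact move_sq hq hq1 (lo_lt_hi i).ne (Or.inr (by simp only [hi]; omega))
  | f_sq i hm =>
    simp only [ff, genAct, map_mul, map_zero, FreeAlgebra.lift_ι_apply]
    exact move_sq hq hq1 (lo_lt_hi i).ne' (Or.inl (by simp only [hi]; omega))
  | e_super a b c hb ha hc =>
    simp only [fe, genAct, map_mul, map_sub, map_add, map_smul, map_zero,
      FreeAlgebra.lift_ι_apply]
    have h1 := lo_lt_hi a
    have h3 := lo_lt_hi c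
    rw [show hi a = lo b from Fin.ext (by simp only [lo, hi]; omega)] at h1 ⊢
    rw [show lo c = hi b from Fin.ext (by simp only [lo, hi]; omega)] at h3 ⊢
    exact move_super_e hq hq1 h1 (lo_lt_hi b) h3 (by simp only [lo]; omega)
      (by simp only [hi]; omega)
  | f_super a b c hb ha hc =>
    simp only [ff, genAct, map_mul, map_sub, map_add, map_smul, map_zero,
      FreeAlgebra.lift_ι_apply]
    have h1 := lo_lt_hi a
    have h3 := lo_lt_hi c
    rw [show hi a = lo b from Fin.ext (by simp only [lo, hi]; omega)] at h1 ⊢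
    rw [show lo c = hi b from Fin.ext (by simp only [lo, hi]; omega)] at h3 ⊢
    exact move_super_f hq hq1 h1 (lo_lt_hi b) h3 (by simp only [lo]; omega)
      (by simp only [hi]; omega)

/-- The action of `U_q(gl(m|n))` on `Ω_q(m|n)`. -/
noncomputable def bigRep (m n : ℕ) {q : K} (hq : q ≠ 0) (hq1 : q - q⁻¹ ≠ 0) :
    BigU m n q →ₐ[K] Module.End K (Omega m n q) :=
  RingQuot.liftAlgHom K ⟨FreeAlgebra.lift K (genAct m n q), fun _ _ h => genAct_rel hq hq1 h⟩

theorem bigRep_toBigU {m n : ℕ} {q : K} (hq : q ≠ 0) (hq1 : q - q⁻¹ ≠ 0)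
    (x : FreeAlgebra K (Gen m n)) :
    bigRep m n hq hq1 (toBigU m n q x) = FreeAlgebra.lift K (genAct m n q) x :=
  RingQuot.liftAlgHom_mkAlgHom_apply _ _ _ _

theorem bigRep_rootE {m n : ℕ} {q : K} (hq : q ≠ 0) (hq1 : q - q⁻¹ ≠ 0) (i d : ℕ)
    (h : i + d + 1 < m + n) :
    IsMove (bigRep m n hq hq1 (rootE m n q i d)) ⟨i, by omega⟩ ⟨i + d + 1, h⟩ := by
  induction d with
  | zero =>
    rw [rootE, eAt, dif_pos (by omega), bigRep_toBigU]
    simp only [fe, FreeAlgebra.lift_ι_apply, genAct]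
    exact isMove_moveOp hq hq1 (lo_lt_hi _).ne
  | succ d ih =>
    have h1 := ih (by omega)
    have h2 : IsMove (bigRep m n hq hq1 (eAt m n q (i + d + 1))) ⟨i + d + 1, by omega⟩
        ⟨i + (d + 1) + 1, h⟩ := by
      rw [eAt, dif_pos (by omega), bigRep_toBigU]
      simp only [fe, FreeAlgebra.lift_ι_apply, genAct]
      exact isMove_moveOp hq hq1 (lo_lt_hi _).ne
    rw [rootE, map_sub, map_smul, map_mul, map_mul]
    exact isMove_sub (isMove_mul₁ (fin_ne (by simp only []; omega)) (fin_ne (by simp only []; omega)) h1 h2)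
      (isMove_smul (isMove_mul₂ h1 h2) _)

theorem bigRep_rootF {m n : ℕ} {q : K} (hq : q ≠ 0) (hq1 : q - q⁻¹ ≠ 0) (i d : ℕ)
    (h : i + d + 1 < m + n) :
    IsMove (bigRep m n hq hq1 (rootF m n q i d)) ⟨i + d + 1, h⟩ ⟨i, by omega⟩ := by
  induction d with
  | zero =>
    rw [rootF, fAt, dif_pos (by omega), bigRep_toBigU]
    simp only [ff, FreeAlgebra.lift_ι_apply, genAct]
    exact isMove_moveOp hq hq1 (lo_lt_hi _).ne'
  | succ d ih =>
    have h1 := ih (by omega)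
    have h2 : IsMove (bigRep m n hq hq1 (fAt m n q (i + d + 1))) ⟨i + (d + 1) + 1, h⟩
        ⟨i + d + 1, by omega⟩ := by
      rw [fAt, dif_pos (by omega), bigRep_toBigU]
      simp only [ff, FreeAlgebra.lift_ι_apply, genAct]
      exact isMove_moveOp hq hq1 (lo_lt_hi _).ne'
    rw [rootF, map_sub, map_smul, map_mul, map_mul]
    exact isMove_sub (isMove_mul₁ (fin_ne (by simp only []; omega)) (fin_ne (by simp only []; omega)) h2 h1)
      (isMove_smul (isMove_mul₂ h2 h1) _)

theorem bigRep_rel {m n : ℕ} {q : K} (hq : q ≠ 0) (hq1 : q - q⁻¹ ≠ 0) (hl : 3 ≤ qChar q)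
    {x y : BigU m n q} (hxy : SmallRel m n q x y) :
    bigRep m n hq hq1 x = bigRep m n hq hq1 y := by
  induction hxy with
  | e_pow i d h =>
    rw [map_pow, map_zero]
    exact isMove_pow hq hl (fin_ne (by simp only []; omega))
      (bigRep_rootE hq hq1 i d (by omega))
  | f_pow i d h =>
    rw [map_pow, map_zero]
    exact isMove_pow hq hl (fin_ne (by simp only []; omega))
      (bigRep_rootF hq hq1 i d (by omega))
  | k_pow i =>
    rw [map_pow, map_one, bigRep_toBigU, fk, FreeAlgebra.lift_ι_apply]
    refine diag_pow i ?_
    have h2 := q_pow_two hq hl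
    unfold qi
    split_ifs
    · exact h2
    · rw [inv_pow, h2, inv_one]

/-- The action of `u_q(gl(m|n))` on `Ω_q(m|n)`. -/
noncomputable def smallRep [CharZero K] (m n : ℕ) {q : K} (hl : 3 ≤ qChar q) :
    SmallU m n q →ₐ[K] Module.End K (Omega m n q) :=
  RingQuot.liftAlgHom K ⟨bigRep m n (q_facts hl).1 (q_facts hl).2,
    fun _ _ h => bigRep_rel (q_facts hl).1 (q_facts hl).2 hl h⟩

/-- `Ω_q(m|n)` is a `u_q(gl(m|n))`-module for `char(q) ≥ 3`. -/
noncomputable instance instModuleOmega [CharZero K] (m n : ℕ) (q : K) [hl : Fact (3 ≤ qChar q)] :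
    Module (SmallU m n q) (Omega m n q) :=
  Module.compHom (Omega m n q) (smallRep m n hl.out).toRingHom

/-- The quotient map from `U_q(gl(m|n))` to `u_q(gl(m|n))`. -/
def bigToSmall (m n : ℕ) (q : K) : BigU m n q →ₐ[K] SmallU m n q :=
  RingQuot.mkAlgHom K (SmallRel m n q)

theorem smallRep_bigToSmall [CharZero K] {m n : ℕ} {q : K} (hl : 3 ≤ qChar q)
    (x : BigU m n q) :
    smallRep m n hl (bigToSmall m n q x) = bigRep m n (q_facts hl).1 (q_facts hl).2 x :=
  RingQuot.liftAlgHom_mkAlgHom_apply _ _ _ _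

/-- The class in `u_q(gl(m|n))` of an element of the free algebra. -/
def toSmallU (m n : ℕ) (q : K) : FreeAlgebra K (Gen m n) →ₐ[K] SmallU m n q :=
  (bigToSmall m n q).comp (toBigU m n q)

theorem toSmallU_surjective (m n : ℕ) (q : K) : Function.Surjective (toSmallU m n q) :=
  (RingQuot.mkAlgHom_surjective K (SmallRel m n q)).comp
    (RingQuot.mkAlgHom_surjective K (URel m n q))

/-- The generators act through `genAct`. -/
theorem toSmallU_smul [CharZero K] {m n : ℕ} {q : K} [hl : Fact (3 ≤ qChar q)]
    (x : FreeAlgebra K (Gen m n)) (v : Omega m n q) :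
    toSmallU m n q x • v = FreeAlgebra.lift K (genAct m n q) x v := by
  change smallRep m n hl.out (bigToSmall m n q (toBigU m n q x)) v = _
  rw [smallRep_bigToSmall, bigRep_toBigU]

theorem genAct_homog {m n : ℕ} {q : K} (hq : q ≠ 0) (hq1 : q - q⁻¹ ≠ 0) (s : ℕ) (g : Gen m n)
    {v : Omega m n q} (hv : v ∈ Submodule.span K
      {w : Omega m n q | ∃ a : Expo m n, ∑ i, a.1 i = s ∧ w = Finsupp.single a 1}) :
    genAct m n q g v ∈ Submodule.span K
      {w : Omega m n q | ∃ a : Expo m n, ∑ i, a.1 i = s ∧ w = Finsupp.single a 1} := by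
  have hmon : ∀ b : Fin (m + n) → ℤ, ∑ i, b i = (s : ℤ) → monZ m n q b ∈ Submodule.span K
      {w : Omega m n q | ∃ a : Expo m n, ∑ i, a.1 i = s ∧ w = Finsupp.single a 1} := by
    intro b hb
    by_cases hA : Adm m n b
    · obtain ⟨a, rfl⟩ := exists_coe hA
      rw [monZ_coe]
      exact Submodule.subset_span ⟨a, by dsimp only at hb; exact_mod_cast hb, rfl⟩
    · rw [monZ_of_not hA]
      exact zero_mem _
  have hmove : ∀ (i j : Fin (m + n)) (a : Expo m n), i ≠ j → ∑ i, a.1 i = s →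
      moveOp m n q i j (Finsupp.single a 1) ∈ Submodule.span K
      {w : Omega m n q | ∃ a : Expo m n, ∑ i, a.1 i = s ∧ w = Finsupp.single a 1} := by
    intro i j a hij ha
    rw [← monZ_coe, moveOp_monZ hq hq1 hij]
    refine Submodule.smul_mem _ _ (hmon _ ?_)
    simp only [Pi.add_apply, Pi.sub_apply, Finset.sum_add_distrib, Finset.sum_sub_distrib, eps,
      Finset.sum_pi_single', Finset.mem_univ, if_true]
    have : (∑ i, (a.1 i : ℤ)) = s := by exact_mod_cast ha
    omega
  have hdiag : ∀ (i : Fin (m + n)) (c : K) (a : Expo m n), ∑ i, a.1 i = s →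
      diagOp m n q i c (Finsupp.single a 1) ∈ Submodule.span K
      {w : Omega m n q | ∃ a : Expo m n, ∑ i, a.1 i = s ∧ w = Finsupp.single a 1} := by
    intro i c a ha
    rw [← monZ_coe, diagOp_monZ, monZ_coe]
    exact Submodule.smul_mem _ _ (Submodule.subset_span ⟨a, ha, rfl⟩)
  induction hv using Submodule.span_induction with
  | mem w hw =>
    obtain ⟨a, ha, rfl⟩ := hw
    cases g with
    | e j => exact hmove _ _ a (lo_lt_hi j).ne ha
    | f j => exact hmove _ _ a (lo_lt_hi j).ne' ha
    | k i => exact hdiag _ _ a ha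
    | kinv i => exact hdiag _ _ a ha
  | zero => rw [map_zero]; exact zero_mem _
  | add x y _ _ hx hy => rw [map_add]; exact add_mem hx hy
  | smul c x _ hx => rw [map_smul]; exact Submodule.smul_mem _ _ hx

/-- The homogeneous component `Ω_q^(s)(m|n)`: the `u_q(gl(m|n))`-submodule of `Ω_q(m|n)` whose
underlying space is the `K`-span of the monomials of total degree `s`. -/
noncomputable def homog [CharZero K] (m n : ℕ) (q : K) [hl : Fact (3 ≤ qChar q)] (s : ℕ) :
    Submodule (SmallU m n q) (Omega m n q) where
  carrier := Submodule.span K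
    {w : Omega m n q | ∃ a : Expo m n, ∑ i, a.1 i = s ∧ w = Finsupp.single a 1}
  add_mem' := add_mem
  zero_mem' := zero_mem _
  smul_mem' := by
    intro u v hv
    obtain ⟨x, rfl⟩ := toSmallU_surjective m n q u
    rw [toSmallU_smul]
    induction x using FreeAlgebra.induction generalizing v with
    | grade0 r =>
      rw [AlgHom.commutes]
      exact Submodule.smul_mem _ r hv
    | grade1 g =>
      rw [FreeAlgebra.lift_ι_apply]
      exact genAct_homog (q_facts hl.out).1 (q_facts hl.out).2 s g hv
    | mul x y hx hy =>
      rw [map_mul, Module.End.mul_apply]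
      exact hx (hy hv)
    | add x y hx hy =>
      rw [map_add, LinearMap.add_apply]
      exact add_mem (hx hv) (hy hv)

end Action

end QGrass

/-! Each `e_k`, `f_k` carries a monomial to a multiple of one monomial, so the component of degree
`s` is governed by a directed graph on exponents: an edge leads from `a` to an admissible `a + ε_i -
ε_j`, with `i`, `j` adjacent and `a_j ≥ 1`, when `[a_i + 1] ≠ 0`, that is, when `ℓ ∤ a_i + 1`. The
energy of `a` is the sum of `⌊a_i / ℓ⌋` over even `i`. It never rises along an edge, since the
raised entry keeps its quotient. Exponents of equal degree with the same quotients form a cell, and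
inside a cell everything reaches everything (`reach_of_div_eq`). The weight determines the even
entries modulo `ℓ` and the odd entries exactly; hence distinct exponents of a cell have distinct
weights, and in fixed degree the weight determines the energy.

Rigidity: let `F_E` be the span of the monomials of energy less than `E`. Each cell of energy `E`
contributes a simple summand of `F_{E+1} / F_E` (`supportedOn_covBy`), so this layer is semisimple.
Every exponent leads down to every level between the minimal energy and its own
(`exists_reach_energy_eq`), so a submodule covering `F_E` must lie in `F_{E+1}`: the layer is the
whole socle of the quotient by `F_E`. Every exponent is reached from each level above it up to `s /
ℓ` (`exists_energy_eq_reach`), so a maximal submodule of `F_{E+1}` must contain `F_E`, which is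
therefore the radical. Both series are thus the energy filtration.

Indecomposability: every endomorphism `φ` is a scalar, so a projection is `0` or the identity. The
coefficient of `x^b` in `φ(x^a)` vanishes unless the weights agree, and it does not change when `a`
and `b` are moved together. Write `a = u + p` and `b = u + p'` with `u = min(a, b)`. As an
undirected graph the exponents of a given degree are connected (`eqvGen_of_sum_eq`; three indices
are needed), so the coefficient depends on `u` only through its degree. If `a ≠ b`, then `u` can be
replaced by an exponent for which some generator kills `x^(u+p)` but not the `x^(u+p')` term, and
the coefficient is `0`. If `a = b`, the same invariance makes all diagonal coefficients equal. -/

namespace QGrass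

/-! ### Moves of one unit between entries of an exponent -/

section Moves

/-- The tuple `a + ε_i - ε_j`, for `i ≠ j` and `1 ≤ a_j`. -/
def mv {N : ℕ} (i j : Fin N) (a : Fin N → ℕ) : Fin N → ℕ := fun k =>
  if k = i then a i + 1 else if k = j then a j - 1 else a k

theorem mv_left {N : ℕ} (i j : Fin N) (a : Fin N → ℕ) : mv i j a i = a i + 1 := by simp [mv]

theorem mv_right {N : ℕ} {i j : Fin N} (h : i ≠ j) (a : Fin N → ℕ) : mv i j a j = a j - 1 := by
  simp [mv, h.symm]

theorem mv_other {N : ℕ} {i j k : Fin N} (hi : k ≠ i) (hj : k ≠ j) (a : Fin N → ℕ) :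
    mv i j a k = a k := by
  simp [mv, hi, hj]

theorem mv_mv_symm {N : ℕ} {i j : Fin N} (hij : i ≠ j) {a : Fin N → ℕ} (hj : 1 ≤ a j) :
    mv j i (mv i j a) = a := by
  funext k
  simp only [mv]
  split_ifs <;> subst_vars <;> simp_all

theorem mv_mv_left {N : ℕ} {i j k : Fin N} (hij : i ≠ j) (hik : i ≠ k) (hjk : j ≠ k)
    (a : Fin N → ℕ) : mv i k (mv k j a) = mv i j a := by
  funext l
  simp only [mv]
  split_ifs <;> subst_vars <;> simp_all

theorem mv_mv_right {N : ℕ} {i j k : Fin N} (hij : i ≠ j) (hik : i ≠ k) (hjk : j ≠ k)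
    {a : Fin N → ℕ} (hk : 1 ≤ a k) : mv k j (mv i k a) = mv i j a := by
  funext l
  simp only [mv]
  split_ifs <;> subst_vars <;> simp_all

theorem sum_mv {N : ℕ} (f : Fin N → ℕ → ℕ) {i j : Fin N} (hij : i ≠ j) (a : Fin N → ℕ) :
    ∑ k, f k (mv i j a k) + f i (a i) + f j (a j) =
      ∑ k, f k (a k) + f i (a i + 1) + f j (a j - 1) := by
  have hj : j ∈ Finset.univ.erase i := by simp [hij.symm]
  rw [← Finset.add_sum_erase _ _ (Finset.mem_univ i), ← Finset.add_sum_erase _ _ hj,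
    ← Finset.add_sum_erase _ (fun k => f k (a k)) (Finset.mem_univ i),
    ← Finset.add_sum_erase _ (fun k => f k (a k)) hj, mv_left, mv_right hij]
  have : ∑ x ∈ (Finset.univ.erase i).erase j, f x (mv i j a x) =
      ∑ x ∈ (Finset.univ.erase i).erase j, f x (a x) := by
    refine Finset.sum_congr rfl fun k hk => ?_
    rw [Finset.mem_erase, Finset.mem_erase] at hk
    rw [mv_other hk.2.1 hk.1]
  rw [this]
  ring

theorem sum_mv_id {N : ℕ} {i j : Fin N} (hij : i ≠ j) {a : Fin N → ℕ} (hj : 1 ≤ a j) :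
    ∑ k, mv i j a k = ∑ k, a k := by
  have := sum_mv (fun _ x => x) hij a
  omega

variable {m n : ℕ}

/-- The admissible exponent `a + ε_i - ε_j`. -/
def Expo.mv (a : Expo m n) (i j : Fin (m + n)) (hi : m ≤ (i : ℕ) → a.1 i = 0) : Expo m n :=
  ⟨QGrass.mv i j a.1, fun k hk => by
    have := a.2 k hk
    unfold QGrass.mv
    split_ifs with h1 h2
    · subst h1; rw [hi hk]
    · subst h2; omega
    · exact this⟩

/-- The monomial `x^a` is carried by some `e_k` or `f_k` to a nonzero multiple of `x^a'`. -/
def Step (l : ℕ) (a a' : Expo m n) : Prop :=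
  ∃ i j : Fin (m + n), ((i : ℕ) + 1 = j ∨ (j : ℕ) + 1 = i) ∧ 1 ≤ a.1 j ∧ ¬ l ∣ a.1 i + 1 ∧
    a'.1 = mv i j a.1

/-- The reflexive transitive closure of `Step`. -/
abbrev Reach (l : ℕ) : Expo m n → Expo m n → Prop := Relation.ReflTransGen (Step l)

theorem not_dvd_of_dvd_succ {l x : ℕ} (hl : 2 ≤ l) (h : l ∣ x + 1) : ¬ l ∣ x := fun h' => by
  have := (Nat.dvd_add_right h').1 h
  have := Nat.le_of_dvd one_pos this
  omega

/-- Entry `k` has room if it can be raised with a nonzero coefficient. An entry without room is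
nonempty and can be refilled after it has lost a unit, the coefficient of the refill being `[a_k] ≠
0`. -/
theorem one_le_of_not_room {l : ℕ} (hl : 3 ≤ l) (a : Expo m n) {k : Fin (m + n)}
    (hk : ¬ (¬ l ∣ a.1 k + 1 ∧ (m ≤ (k : ℕ) → a.1 k = 0))) : 1 ≤ a.1 k ∧ ¬ l ∣ a.1 k := by
  by_cases hd : l ∣ a.1 k + 1
  · refine ⟨?_, not_dvd_of_dvd_succ (by omega) hd⟩
    have := Nat.le_of_dvd (by omega) hd
    omega
  · have h1 : m ≤ (k : ℕ) ∧ a.1 k ≠ 0 := by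
      by_contra hc
      exact hk ⟨hd, fun hm => by by_contra h0; exact hc ⟨hm, h0⟩⟩
    have h2 : a.1 k = 1 := by have := a.2 k h1.1; omega
    refine ⟨h2.ge, fun h3 => ?_⟩
    rw [h2] at h3
    have := Nat.le_of_dvd one_pos h3
    omega

/-- The unit passes through the neighbour `k` of `j`. If `k` has room, `j` gives to `k` before `k`
gives to `i`; otherwise `k` gives to `i` first and is then refilled from `j`. -/
theorem reach_mv {l : ℕ} (hl : 3 ≤ l) (d : ℕ) : ∀ (a a' : Expo m n) (i j : Fin (m + n)),
    ((i : ℕ) + (d + 1) = j ∨ (j : ℕ) + (d + 1) = i) → 1 ≤ a.1 j → ¬ l ∣ a.1 i + 1 →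
    a'.1 = mv i j a.1 → Reach l a a' := by
  induction d with
  | zero => intro a a' i j hij hj hi h; exact .single ⟨i, j, hij, hj, hi, h⟩
  | succ d ih =>
    intro a a' i j hij hj hi h
    obtain ⟨k, hik, hkj⟩ : ∃ k : Fin (m + n), ((i : ℕ) + (d + 1) = k ∨ (k : ℕ) + (d + 1) = i) ∧
        ((k : ℕ) + 1 = j ∨ (j : ℕ) + 1 = k) := by
      rcases hij with hij | hij
      · exact ⟨⟨i + (d + 1), by omega⟩, Or.inl rfl, Or.inl (by simp only []; omega)⟩
      · exact ⟨⟨j + 1, by omega⟩, Or.inr (by simp only []; omega), Or.inr rfl⟩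
    have nij : i ≠ j := fin_ne (by omega)
    have nik : i ≠ k := fin_ne (by omega)
    have njk : j ≠ k := fin_ne (by omega)
    by_cases hk : ¬ l ∣ a.1 k + 1 ∧ (m ≤ (k : ℕ) → a.1 k = 0)
    · refine .head (b := a.mv k j hk.2) ⟨k, j, hkj, hj, hk.1, rfl⟩ (ih _ _ i k hik ?_ ?_ ?_)
      · change 1 ≤ mv k j a.1 k
        rw [mv_left]; omega
      · change ¬ l ∣ mv k j a.1 i + 1
        rwa [mv_other nik nij]
      · exact h.trans (mv_mv_left nij nik njk a.1).symm
    · have hodd : m ≤ (i : ℕ) → a.1 i = 0 := fun hm => by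
        have := a'.2 i hm
        rw [h, mv_left] at this
        omega
      have hk' := one_le_of_not_room hl a hk
      refine .tail (b := a.mv i k hodd) (ih _ _ i k hik hk'.1 hi rfl) ⟨k, j, hkj, ?_, ?_, ?_⟩
      · change 1 ≤ mv i k a.1 j
        rwa [mv_other nij.symm njk]
      · change ¬ l ∣ mv i k a.1 k + 1
        rw [mv_right nik, Nat.sub_add_cancel hk'.1]
        exact hk'.2
      · exact h.trans (mv_mv_right nij nik njk hk'.1).symm

theorem reach_of_eq_mv {l : ℕ} (hl : 3 ≤ l) {a a' : Expo m n} {i j : Fin (m + n)} (hij : i ≠ j)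
    (hj : 1 ≤ a.1 j) (hi : ¬ l ∣ a.1 i + 1) (h : a'.1 = mv i j a.1) : Reach l a a' := by
  rcases Nat.lt_or_gt_of_ne (fun e => hij (Fin.ext e)) with hlt | hlt
  · exact reach_mv hl (j - i - 1) a a' i j (Or.inl (by omega)) hj hi h
  · exact reach_mv hl (i - j - 1) a a' i j (Or.inr (by omega)) hj hi h

theorem Step.sum_eq {l : ℕ} {a a' : Expo m n} (h : Step l a a') : ∑ i, a'.1 i = ∑ i, a.1 i := by
  obtain ⟨i, j, hij, hj, -, h⟩ := h
  rw [h, sum_mv_id (fin_ne (by omega)) hj]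

theorem Reach.sum_eq {l : ℕ} {a a' : Expo m n} (h : Reach l a a') :
    ∑ i, a'.1 i = ∑ i, a.1 i := by
  induction h with
  | refl => rfl
  | tail _ h ih => rw [h.sum_eq, ih]

/-! ### Energy, and reachability within and between its levels -/

/-- The energy of an exponent: the sum of the quotients of its even entries by `l`. -/
def energy (l : ℕ) (a : Expo m n) : ℕ := ∑ i : Fin (m + n), if (i : ℕ) < m then a.1 i / l else 0

/-- The remainder of an even entry modulo `l`, and an odd entry itself. -/
def res (m l i x : ℕ) : ℕ := if i < m then x % l else x

/-- The largest possible value of `res`. -/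
def resMax (m l i : ℕ) : ℕ := if i < m then l - 1 else 1

/-- Division with remainder in each even entry. In fixed degree, energy and total residue determine
each other. -/
theorem sum_eq_energy (l : ℕ) (a : Expo m n) :
    ∑ i, a.1 i = l * energy l a + ∑ i : Fin (m + n), res m l i (a.1 i) := by
  rw [energy, Finset.mul_sum, ← Finset.sum_add_distrib]
  refine Finset.sum_congr rfl fun i _ => ?_
  unfold res
  split_ifs
  · exact (Nat.div_add_mod _ _).symm
  · simp

theorem res_le_resMax {l : ℕ} (hl : 0 < l) (a : Expo m n) (i : Fin (m + n)) :
    res m l i (a.1 i) ≤ resMax m l i := by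
  unfold res resMax
  split_ifs with h
  · have := Nat.mod_lt (a.1 i) hl; omega
  · exact a.2 i (not_lt.1 h)

theorem succ_mod_div {l x : ℕ} (h : ¬ l ∣ x + 1) :
    (x + 1) / l = x / l ∧ (x + 1) % l = x % l + 1 := by
  have h1 : (x + 1) / l = x / l := by rw [Nat.succ_div, if_neg h, add_zero]
  refine ⟨h1, ?_⟩
  have h2 := Nat.div_add_mod x l
  have h3 := Nat.div_add_mod (x + 1) l
  rw [h1] at h3
  omega

theorem succ_mod_div_of_dvd {l x : ℕ} (h : l ∣ x + 1) :
    (x + 1) / l = x / l + 1 := by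
  rw [Nat.succ_div, if_pos h]

/-- The effect on the energy of a move that reaches a nonzero monomial. -/
theorem energy_mv {l : ℕ} {a a' : Expo m n} {i j : Fin (m + n)} (hij : i ≠ j)
    (hj : 1 ≤ a.1 j) (hi : ¬ l ∣ a.1 i + 1) (h : a'.1 = mv i j a.1) :
    energy l a = energy l a' + if (j : ℕ) < m ∧ l ∣ a.1 j then 1 else 0 := by
  have key := sum_mv (fun k x => if (k : ℕ) < m then x / l else 0) hij a.1
  rw [← h] at key
  change energy l a' + _ + _ = energy l a + _ + _ at key
  have h1 := (succ_mod_div hi).1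
  obtain ⟨y, hy⟩ : ∃ y, a.1 j = y + 1 := ⟨a.1 j - 1, by omega⟩
  rw [h1, hy, Nat.add_sub_cancel] at key
  rw [hy]
  by_cases hjm : (j : ℕ) < m
  · by_cases hd : l ∣ y + 1
    · have := succ_mod_div_of_dvd hd
      simp only [hjm, hd, and_self, if_true, this] at key ⊢
      omega
    · have := (succ_mod_div hd).1
      simp only [hjm, hd, and_false, if_true, if_false, this] at key ⊢
      omega
  · simp only [hjm, false_and, if_false] at key ⊢
    omega

theorem Step.energy_le {l : ℕ} {a a' : Expo m n} (h : Step l a a') :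
    energy l a' ≤ energy l a := by
  obtain ⟨i, j, hij, hj, hi, h⟩ := h
  rw [energy_mv (fin_ne (by omega)) hj hi h]
  exact Nat.le_add_right _ _

/-- Induction on the excess of `a` over `b`: a unit goes from an entry `j` with `a_j > b_j` to an
entry `i` with `a_i < b_i`. For even `i`, `a_i + 1 ≤ b_i` stays in the block of `a_i` modulo `l`, so
the move has a nonzero coefficient, and the quotients are preserved. -/
theorem reach_of_div_eq {l : ℕ} (hl : 3 ≤ l) {b : Expo m n} (d : ℕ) : ∀ a : Expo m n,
    ∑ i, (a.1 i - b.1 i) ≤ d → ∑ i, a.1 i = ∑ i, b.1 i →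
    (∀ i : Fin (m + n), (i : ℕ) < m → a.1 i / l = b.1 i / l) → Reach l a b := by
  induction d with
  | zero =>
    intro a hd hs _
    have hle : ∀ i, a.1 i ≤ b.1 i := fun i => by
      have := (Finset.sum_eq_zero_iff.1 (Nat.le_zero.1 hd)) i (Finset.mem_univ i)
      omega
    have h : a = b := Subtype.ext (funext fun i =>
      (Finset.sum_eq_sum_iff_of_le fun i _ => hle i).1 hs i (Finset.mem_univ i))
    rw [h]
  | succ d ih =>
    intro a hd hs hab
    by_cases hle : ∀ i, a.1 i ≤ b.1 i
    · exact ih a (by rw [Finset.sum_eq_zero fun i _ => Nat.sub_eq_zero_of_le (hle i)]; omega) hs hab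
    obtain ⟨j, hj⟩ := not_forall.1 hle
    obtain ⟨i, hi⟩ : ∃ i, a.1 i < b.1 i := by
      by_contra hc
      have hc' : ∀ i, b.1 i ≤ a.1 i := fun i => not_lt.1 fun h => hc ⟨i, h⟩
      have := (Finset.sum_eq_sum_iff_of_le fun i _ => hc' i).1 hs.symm j (Finset.mem_univ j)
      omega
    have hij : i ≠ j := by rintro rfl; omega
    have hl0 : 0 < l := by omega
    have hodd : m ≤ (i : ℕ) → a.1 i = 0 := fun hm => by have := b.2 i hm; omega
    have hroom : (a.1 i + 1) / l = a.1 i / l ∧ ¬ l ∣ a.1 i + 1 := by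
      by_cases him : (i : ℕ) < m
      · have h1 : (a.1 i + 1) / l = a.1 i / l := by
          have h2 := Nat.div_le_div_right (c := l) (show a.1 i + 1 ≤ b.1 i from hi)
          rw [← hab i him] at h2
          exact le_antisymm h2 (Nat.div_le_div_right (Nat.le_succ _))
        refine ⟨h1, fun hd => ?_⟩
        rw [succ_mod_div_of_dvd hd] at h1
        omega
      · rw [hodd (not_lt.1 him)]
        have h1 : ¬ l ∣ 0 + 1 := fun h => by have := Nat.le_of_dvd one_pos h; omega
        exact ⟨(succ_mod_div h1).1, h1⟩
    refine .trans (reach_of_eq_mv hl hij (by omega) hroom.2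
      (show (a.mv i j hodd).1 = mv i j a.1 from rfl)) (ih _ ?_ ?_ ?_)
    · have key := sum_mv (fun k x => x - b.1 k) hij a.1
      change ∑ k, ((a.mv i j hodd).1 k - b.1 k) + _ + _ = _ at key
      omega
    · exact (sum_mv_id hij (by omega)).trans hs
    · intro k hk
      change mv i j a.1 k / l = b.1 k / l
      by_cases hki : k = i
      · subst hki
        rw [mv_left, hroom.1, hab k hk]
      · by_cases hkj : k = j
        · subst hkj
          rw [mv_right hij]
          apply le_antisymm
          · rw [← hab k hk]
            exact Nat.div_le_div_right (Nat.sub_le _ _)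
          · exact Nat.div_le_div_right (by omega)
        · rw [mv_other hki hkj, hab k hk]

/-- If every entry other than `j` had its maximal residue, the whole deficit, at least `l`, would
sit at `j`, where it is at most `l - 1`. -/
theorem exists_room {l : ℕ} (hl : 3 ≤ l) {j : Fin (m + n)} (hjm : (j : ℕ) < m) (a : Expo m n)
    (hsum : ∑ i : Fin (m + n), res m l i (a.1 i) + l ≤ ∑ i : Fin (m + n), resMax m l i) :
    ∃ i, i ≠ j ∧ ¬ l ∣ a.1 i + 1 ∧ (m ≤ (i : ℕ) → a.1 i = 0) := by
  by_contra hc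
  have hmax : ∀ i, i ≠ j → resMax m l i ≤ res m l i (a.1 i) := by
    intro i hij
    by_contra hlt
    refine hc ⟨i, hij, ?_⟩
    unfold res resMax at hlt
    split_ifs at hlt with him
    · refine ⟨fun hd => hlt ?_, fun h => by omega⟩
      by_contra h
      have h1 := Nat.div_add_mod (a.1 i) l
      have h2 : l ∣ a.1 i % l + 1 := by
        rw [← h1, add_assoc] at hd
        exact (Nat.dvd_add_right (dvd_mul_right _ _)).1 hd
      have := Nat.le_of_dvd (by omega) h2
      omega
    · have h0 : a.1 i = 0 := by omega
      refine ⟨fun hd => ?_, fun _ => h0⟩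
      rw [h0] at hd
      have := Nat.le_of_dvd one_pos hd
      omega
  rw [← Finset.add_sum_erase _ _ (Finset.mem_univ j),
    ← Finset.add_sum_erase _ (fun i : Fin (m + n) => resMax m l i) (Finset.mem_univ j)] at hsum
  have h1 : ∑ i ∈ Finset.univ.erase j, resMax m l i ≤
      ∑ i ∈ Finset.univ.erase j, res m l i (a.1 i) :=
    Finset.sum_le_sum fun i hi => hmax i (Finset.ne_of_mem_erase hi)
  have h2 : resMax m l j = l - 1 := if_pos hjm
  omega

/-- An energy above the minimal one can be lowered by one. -/
theorem exists_reach_energy_pred {l : ℕ} (hl : 3 ≤ l) {j : Fin (m + n)} (hjm : (j : ℕ) < m)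
    (d : ℕ) : ∀ a : Expo m n, a.1 j % l = d → l ≤ a.1 j →
    ∑ i : Fin (m + n), res m l i (a.1 i) + l ≤ ∑ i : Fin (m + n), resMax m l i →
    ∃ a', Reach l a a' ∧ energy l a = energy l a' + 1 := by
  have hl0 : 0 < l := by omega
  induction d with
  | zero =>
    intro a hd hla hsum
    obtain ⟨i, hij, hi, hodd⟩ := exists_room hl hjm a hsum
    -- Here `l ∣ a_j`, so the loss of a unit lowers the quotient of entry `j`.
    refine ⟨a.mv i j hodd, reach_of_eq_mv hl hij (by omega) hi rfl, ?_⟩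
    rw [energy_mv hij (by omega) hi (show (a.mv i j hodd).1 = mv i j a.1 from rfl),
      if_pos ⟨hjm, Nat.dvd_of_mod_eq_zero hd⟩]
  | succ d ih =>
    intro a hd hla hsum
    obtain ⟨i, hij, hi, hodd⟩ := exists_room hl hjm a hsum
    have hr := reach_of_eq_mv hl hij (by omega) hi
      (show (a.mv i j hodd).1 = mv i j a.1 from rfl)
    have hnd : ¬ l ∣ a.1 j := fun h => by have := Nat.mod_eq_zero_of_dvd h; omega
    have hen := energy_mv hij (by omega) hi (show (a.mv i j hodd).1 = mv i j a.1 from rfl)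
    rw [if_neg (fun h => hnd h.2), add_zero] at hen
    have hj : (a.mv i j hodd).1 j = a.1 j - 1 := mv_right hij a.1
    have hne : a.1 j ≠ l := fun h => hnd (h ▸ dvd_rfl)
    -- Degree and energy are unchanged, hence so is the total residue, and the deficit `l` persists.
    obtain ⟨a', h1, h2⟩ := ih (a.mv i j hodd) (by
        rw [hj]
        obtain ⟨y, hy⟩ : ∃ y, a.1 j = y + 1 := ⟨a.1 j - 1, by omega⟩
        rw [hy] at hnd hd ⊢
        have := (succ_mod_div hnd).2
        rw [Nat.add_sub_cancel]; omega) (by omega) (by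
        have e1 := sum_eq_energy l a
        have e2 := sum_eq_energy l (a.mv i j hodd)
        rw [hr.sum_eq, ← hen] at e2
        omega)
    exact ⟨a', hr.trans h1, hen.trans h2⟩

/-- The edges are followed backwards: entry `j` gains units until its quotient goes up. The number
`d` counts the units still missing to residue `l - 1`; one further unit raises the energy. -/
theorem exists_reach_energy_succ {l : ℕ} (hl : 3 ≤ l) {j : Fin (m + n)} (hjm : (j : ℕ) < m)
    (d : ℕ) : ∀ a : Expo m n, a.1 j % l + d = l - 1 → l * (energy l a + 1) ≤ ∑ i, a.1 i →
    ∃ a', Reach l a' a ∧ energy l a' = energy l a + 1 := by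
  have hl0 : 0 < l := by omega
  have main : ∀ a : Expo m n, l * (energy l a + 1) ≤ ∑ i, a.1 i →
      ∃ a' : Expo m n, Reach l a' a ∧ a'.1 j = a.1 j + 1 ∧
        energy l a' = energy l a + if l ∣ a.1 j + 1 then 1 else 0 := by
    intro a hs
    -- An entry with nonzero residue besides `j`. Without one the degree would be `l * energy` plus
    -- a residue below `l`, contradicting `hs`.
    obtain ⟨i, hij, hi, hi0⟩ : ∃ i, i ≠ j ∧ ¬ l ∣ a.1 i ∧ 1 ≤ a.1 i := by
      by_contra hc
      have h0 : ∀ i, i ≠ j → res m l i (a.1 i) = 0 := by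
        intro i hij
        unfold res
        by_contra h
        refine hc ⟨i, hij, fun hd => h ?_, ?_⟩
        · split_ifs with him
          · exact Nat.mod_eq_zero_of_dvd hd
          · have := a.2 i (not_lt.1 him)
            by_contra h1
            have := Nat.le_of_dvd (by omega) hd
            omega
        · by_contra h1
          rw [show a.1 i = 0 by omega] at h
          simp at h
      have e := sum_eq_energy l a
      rw [Finset.sum_eq_single j (fun i _ hij => h0 i hij) (by simp)] at e
      have := Nat.mod_lt (a.1 j) hl0
      rw [res, if_pos hjm] at e
      rw [mul_add] at hs
      omega
    have hodd : m ≤ (j : ℕ) → a.1 j = 0 := fun h => by omega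
    have hb : (a.mv j i hodd).1 = mv j i a.1 := rfl
    have hback : a.1 = mv i j (a.mv j i hodd).1 := by
      rw [hb, mv_mv_symm hij.symm hi0]
    have hbi : (a.mv j i hodd).1 i = a.1 i - 1 := mv_right hij.symm a.1
    have hbj : (a.mv j i hodd).1 j = a.1 j + 1 := mv_left j i a.1
    have hroom : ¬ l ∣ (a.mv j i hodd).1 i + 1 := by rwa [hbi, Nat.sub_add_cancel hi0]
    refine ⟨a.mv j i hodd, reach_of_eq_mv hl hij (by omega) hroom hback, hbj, ?_⟩
    have := energy_mv hij (by omega) hroom hback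
    rw [hbj] at this
    simpa only [hjm, true_and] using this
  induction d with
  | zero =>
    intro a hd hs
    obtain ⟨a', h1, -, h2⟩ := main a hs
    refine ⟨a', h1, ?_⟩
    rw [h2, if_pos]
    by_contra h
    have := (succ_mod_div h).2
    have := Nat.mod_lt (a.1 j + 1) hl0
    omega
  | succ d ih =>
    intro a hd hs
    obtain ⟨a', h1, hj, h2⟩ := main a hs
    split_ifs at h2 with hdv
    · exact ⟨a', h1, h2⟩
    · have h3 := (succ_mod_div hdv).2
      rw [add_zero] at h2
      obtain ⟨b, hb, hb'⟩ := ih a' (by rw [hj]; omega) (by rw [h2, ← h1.sum_eq]; exact hs)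
      exact ⟨b, hb.trans h1, by omega⟩

/-! ### Connectedness of the exponents of a given degree -/

theorem exists_ne_ne {N : ℕ} (hN : 3 ≤ N) (i j : Fin N) : ∃ k : Fin N, k ≠ i ∧ k ≠ j := by
  have hc : ({i, j} : Finset (Fin N)).card < (Finset.univ : Finset (Fin N)).card := by
    rw [Finset.card_univ, Fintype.card_fin]
    exact lt_of_le_of_lt Finset.card_le_two (by omega)
  obtain ⟨k, -, hk⟩ := Finset.exists_mem_notMem_of_card_lt_card hc
  simp only [Finset.mem_insert, Finset.mem_singleton, not_or] at hk
  exact ⟨k, hk⟩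

/-- With a third index available, moves towards an even entry connect exponents. -/
theorem eqvGen_of_eq_mv {l : ℕ} (hl : 3 ≤ l) (hmn : 3 ≤ m + n) {a a' : Expo m n}
    {i j : Fin (m + n)} (hij : i ≠ j) (him : (i : ℕ) < m) (hj : 1 ≤ a.1 j)
    (h : a'.1 = mv i j a.1) : Relation.EqvGen (Step l) a a' := by
  have toE : ∀ {x y : Expo m n}, Reach l x y → Relation.EqvGen (Step l) x y :=
    fun h =>
    Relation.ReflTransGen.rec (.refl _) (fun _ h ih => ih.trans _ _ _ (.rel _ _ h)) h
  have hback : a.1 = mv j i a'.1 := by rw [h, mv_mv_symm hij hj]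
  have hi' : a'.1 i = a.1 i + 1 := by rw [h, mv_left]
  have hj' : a'.1 j = a.1 j - 1 := by rw [h, mv_right hij]
  -- The move from `a` to `a'` is blocked only if `l ∣ a_i + 1`, the opposite one only if `l ∣ a_j`.
  -- When both are blocked, a third index `k` gives a detour.
  by_cases h1 : l ∣ a.1 i + 1
  swap
  · exact toE (reach_of_eq_mv hl hij hj h1 h)
  by_cases h2 : l ∣ a.1 j
  swap
  · refine .symm _ _ (toE (reach_of_eq_mv hl hij.symm (by omega) ?_ hback))
    rwa [hj', Nat.sub_add_cancel hj]
  obtain ⟨k, hki, hkj⟩ : ∃ k : Fin (m + n), k ≠ i ∧ k ≠ j :=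
    exists_ne_ne hmn i j
  have hk' : a'.1 k = a.1 k := by rw [h, mv_other hki hkj]
  by_cases hk : ¬ l ∣ a.1 k + 1 ∧ (m ≤ (k : ℕ) → a.1 k = 0)
  · refine .trans _ (a.mv k j hk.2) _ (toE (reach_of_eq_mv hl hkj hj hk.1 rfl)) (.symm _ _ (toE
      (reach_of_eq_mv hl hki (by omega) (by rw [hk']; exact hk.1) ?_)))
    change mv k j a.1 = mv k i a'.1
    rw [h]
    exact (mv_mv_left hkj hki hij.symm a.1).symm
  · have hk1 : 1 ≤ a.1 k ∧ ¬ l ∣ a.1 k := one_le_of_not_room hl a hk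
    have hodd : m ≤ (i : ℕ) → a.1 i = 0 := fun hm => by omega
    have hck : (a.mv i k hodd).1 k = a.1 k - 1 := mv_right hki.symm _
    have hci : (a.mv i k hodd).1 i = a.1 i + 1 := mv_left _ _ _
    have hcj : (a.mv i k hodd).1 j = a.1 j := mv_other hij.symm hkj.symm _
    have hroom : ¬ l ∣ (a.mv i k hodd).1 k + 1 := by
      rw [hck, Nat.sub_add_cancel hk1.1]; exact hk1.2
    -- Both `a` and `a'` are reached from `a + ε_i - ε_k`, by refilling `k` from `i` or from `j`.
    refine .trans _ (a.mv i k hodd) _ (.symm _ _ (toE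
      (reach_of_eq_mv hl hki (by omega) hroom ?_)))
      (toE (reach_of_eq_mv hl hkj (by omega) hroom ?_))
    · exact (mv_mv_symm hki.symm hk1.1).symm
    · rw [h]
      exact (mv_mv_right hij hki.symm hkj.symm hk1.1).symm

/-- The exponents of a given degree are connected under moves. -/
theorem eqvGen_of_sum_eq {l : ℕ} (hl : 3 ≤ l) (hm : 0 < m) (hmn : 3 ≤ m + n) {a b : Expo m n}
    (h : ∑ i, a.1 i = ∑ i, b.1 i) : Relation.EqvGen (Step l) a b := by
  -- All units are gathered in entry `0`, which is even and hence unbounded; this gives a normal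
  -- form depending only on the degree.
  set z : Fin (m + n) := ⟨0, by omega⟩
  have key : ∀ d : ℕ, ∀ a : Expo m n, ∑ i, a.1 i = a.1 z + d → ∃ c : Expo m n,
      (∀ i, i ≠ z → c.1 i = 0) ∧ Relation.EqvGen (Step l) a c ∧ c.1 z = a.1 z + d := by
    intro d
    induction d with
    | zero =>
      intro a ha
      refine ⟨a, fun i hi => ?_, .refl _, rfl⟩
      rw [← Finset.add_sum_erase _ _ (Finset.mem_univ z)] at ha
      exact Finset.sum_eq_zero_iff.1 (show ∑ i ∈ Finset.univ.erase z, a.1 i = 0 by omega) i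
        (by simp [hi])
    | succ d ih =>
      intro a ha
      obtain ⟨j, hjz, hj⟩ : ∃ j, j ≠ z ∧ 1 ≤ a.1 j := by
        by_contra hc
        rw [Finset.sum_eq_single z (fun i _ hi => by
          by_contra h0; exact hc ⟨i, hi, by omega⟩) (by simp)] at ha
        omega
      have hodd : m ≤ (z : ℕ) → a.1 z = 0 := fun h => absurd h (not_le.2 hm)
      have hz : (a.mv z j hodd).1 z = a.1 z + 1 := mv_left z j a.1
      have hs : ∑ i, (a.mv z j hodd).1 i = ∑ i, a.1 i := sum_mv_id hjz.symm hj
      obtain ⟨c, h1, h2, h3⟩ := ih (a.mv z j hodd) (by omega)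
      exact ⟨c, h1, .trans _ _ _ (eqvGen_of_eq_mv hl hmn hjz.symm hm hj rfl) h2, by omega⟩
  have hle : ∀ a : Expo m n, a.1 z ≤ ∑ i, a.1 i := fun a =>
    Finset.single_le_sum (f := a.1) (fun _ _ => Nat.zero_le _) (Finset.mem_univ z)
  have ha := hle a
  have hb := hle b
  obtain ⟨c, hc1, hc2, hc3⟩ := key (∑ i, a.1 i - a.1 z) a (by omega)
  obtain ⟨d, hd1, hd2, hd3⟩ := key (∑ i, b.1 i - b.1 z) b (by omega)
  have : c = d := by
    refine Subtype.ext (funext fun i => ?_)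
    by_cases hi : i = z
    · rw [hi]; omega
    · rw [hc1 i hi, hd1 i hi]
  subst this
  exact hc2.trans _ _ _ (.symm _ _ hd2)

end Moves

/-! ### Socle and radical series through covers in the lattice of submodules -/

section Filtrations

variable {R M : Type*} [Ring R] [AddCommGroup M] [Module R M]

theorem isSimpleModule_iff_covBy_comap_mkQ (P : Submodule R M) (N : Submodule R (M ⧸ P)) :
    IsSimpleModule R N ↔ P ⋖ N.comap P.mkQ := by
  have hle : P ≤ N.comap P.mkQ := by
    intro x hx
    simp [(Submodule.Quotient.mk_eq_zero P).2 hx]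
  rw [isSimpleModule_iff_isAtom, ← bot_covBy_iff]
  constructor
  · intro h
    refine ⟨lt_of_le_of_ne hle fun e => h.1.ne ?_, fun Q hPQ hQN => ?_⟩
    · rw [← Submodule.map_comap_eq_of_surjective P.mkQ_surjective N, ← e, Submodule.mkQ_map_self]
    · refine h.2 (c := Q.map P.mkQ) (bot_lt_iff_ne_bot.2 fun e => ?_)
        (lt_of_le_of_ne (Submodule.map_le_iff_le_comap.2 hQN.le) fun e => ?_)
      · refine hPQ.not_ge ?_
        rw [← Submodule.ker_mkQ P, LinearMap.ker, ← Submodule.map_le_iff_le_comap, e]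
      · rw [← e, Submodule.comap_map_mkQ, sup_eq_right.2 hPQ.le] at hQN
        exact hQN.ne rfl
  · intro h
    refine ⟨bot_lt_iff_ne_bot.2 fun e => h.1.ne ?_, fun Q hQ hQN => ?_⟩
    · rw [e, Submodule.comap_bot, Submodule.ker_mkQ]
    · have hinj : Function.Injective (Submodule.comap P.mkQ) :=
        Submodule.comap_injective_of_surjective P.mkQ_surjective
      have hPQ : P ≤ Q.comap P.mkQ := by
        intro x hx
        simp [(Submodule.Quotient.mk_eq_zero P).2 hx]
      refine h.2 (c := Q.comap P.mkQ) (lt_of_le_of_ne hPQ fun e => hQ.ne ?_)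
        (lt_of_le_of_ne (Submodule.comap_mono hQN.le) fun e => hQN.ne (hinj e))
      apply hinj
      rw [Submodule.comap_bot, Submodule.ker_mkQ, ← e]

/-- Correspondence between submodules of the quotient and submodules above `P`. The term `P` matters
when nothing covers `P`, as the supremum is then `⊥`. -/
theorem comap_mkQ_socle (P : Submodule R M) :
    (socle R (M ⧸ P)).comap P.mkQ = P ⊔ sSup {N | P ⋖ N} := by
  apply le_antisymm
  · have : socle R (M ⧸ P) ≤ (P ⊔ sSup {N | P ⋖ N}).map P.mkQ := by
      refine sSup_le fun N hN => ?_
      rw [← Submodule.map_comap_eq_of_surjective P.mkQ_surjective N]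
      exact Submodule.map_mono
        (le_sup_of_le_right (le_sSup ((isSimpleModule_iff_covBy_comap_mkQ P N).1 hN)))
    refine (Submodule.comap_mono this).trans ?_
    rw [Submodule.comap_map_mkQ, ← sup_assoc, sup_idem]
  · have hle : P ≤ (socle R (M ⧸ P)).comap P.mkQ := by
      intro x hx
      simp [(Submodule.Quotient.mk_eq_zero P).2 hx]
    refine sup_le hle (sSup_le fun N hN => ?_)
    have hN' : P ⋖ N := hN
    have e : (N.map P.mkQ).comap P.mkQ = N := by
      rw [Submodule.comap_map_mkQ, sup_eq_right.2 hN'.le]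
    rw [← Submodule.map_le_iff_le_comap]
    refine le_sSup ?_
    rw [Set.mem_ofPred_eq, isSimpleModule_iff_covBy_comap_mkQ, e]
    exact hN'

theorem isCoatom_iff_map_subtype_covBy (P : Submodule R M) (N : Submodule R P) :
    IsCoatom N ↔ N.map P.subtype ⋖ P := by
  have hinj : Function.Injective (Submodule.map P.subtype) :=
    Submodule.map_injective_of_injective P.injective_subtype
  have htop : (⊤ : Submodule R P).map P.subtype = P := by simp
  have hle : ∀ Q : Submodule R P, Q.map P.subtype ≤ P := fun Q => Submodule.map_subtype_le P Q
  have hcm : ∀ Q : Submodule R P, (Q.map P.subtype).comap P.subtype = Q := fun Q =>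
    Submodule.comap_map_eq_of_injective P.injective_subtype Q
  constructor
  · intro h
    refine ⟨lt_of_le_of_ne (hle N) fun e => h.1 (hinj (e.trans htop.symm)), fun Q hNQ hQP => ?_⟩
    have hQ : (Q.comap P.subtype).map P.subtype = Q := by
      rw [Submodule.map_comap_subtype, inf_eq_right.2 hQP.le]
    have h1 : N < Q.comap P.subtype := by
      refine lt_of_le_of_ne ?_ fun e => hNQ.ne (by rw [e, hQ])
      rw [← hcm N]
      exact Submodule.comap_mono hNQ.le
    have := h.2 _ h1
    rw [this, htop] at hQ
    exact hQP.ne hQ.symm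
  · intro h
    refine ⟨fun e => h.1.ne (by rw [e, htop]), fun Q hQ => ?_⟩
    by_contra hne
    exact h.2 (c := Q.map P.subtype)
      (lt_of_le_of_ne (Submodule.map_mono hQ.le) fun e => hQ.ne (hinj e))
      (lt_of_le_of_ne (hle Q) fun e => hne (hinj (e.trans htop.symm)))

/-- Dual to the description of the socle. The meet with `P` matters when `P` covers nothing, as the
infimum is then `⊤`. -/
theorem map_subtype_jacobson (P : Submodule R M) :
    (Module.jacobson R P).map P.subtype = P ⊓ sInf {N | N ⋖ P} := by
  have hcm : ∀ Q : Submodule R P, (Q.map P.subtype).comap P.subtype = Q := fun Q =>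
    Submodule.comap_map_eq_of_injective P.injective_subtype Q
  apply le_antisymm
  · refine le_inf (Submodule.map_subtype_le P _) (le_sInf fun N hN => ?_)
    have hN' : N ⋖ P := hN
    have e : (N.comap P.subtype).map P.subtype = N := by
      rw [Submodule.map_comap_subtype, inf_eq_right.2 hN'.le]
    rw [← e]
    refine Submodule.map_mono (sInf_le ?_)
    rw [Set.mem_ofPred_eq, isCoatom_iff_map_subtype_covBy, e]
    exact hN'
  · rw [← Submodule.map_comap_subtype]
    refine Submodule.map_mono (le_sInf fun N hN => ?_)
    rw [← hcm N]
    exact Submodule.comap_mono (sInf_le ((isCoatom_iff_map_subtype_covBy P N).1 hN))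

/-- The `hsoc` conditions make `F (k + 1) / F k` the socle of `M / F k`; the `hrad` conditions make
`F k` the radical of `F (k + 1)`. By induction both series are `F`, the radical one read downwards
from `r`, and `hlt` makes `r` least. -/
theorem isRigid_of_filtration (F : ℕ → Submodule R M) (r : ℕ) (h0 : F 0 = ⊥) (hmono : Monotone F)
    (hr : F r = ⊤) (hlt : ∀ k < r, F k ≠ ⊤)
    (hsoc₁ : ∀ k, F (k + 1) ≤ F k ⊔ sSup {N | F k ⋖ N})
    (hsoc₂ : ∀ k N, F k ⋖ N → N ≤ F (k + 1))
    (hrad₁ : ∀ k < r, ∀ N, N ⋖ F (k + 1) → F k ≤ N)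
    (hrad₂ : ∀ k < r, F (k + 1) ⊓ sInf {N | N ⋖ F (k + 1)} ≤ F k) : IsRigid R M := by
  have hsoc : ∀ k, socSeries R M k = F k := by
    intro k
    induction k with
    | zero => exact h0.symm
    | succ k ih =>
      rw [socSeries, comap_mkQ_socle, ih]
      exact le_antisymm (sup_le (hmono k.le_succ) (sSup_le fun N hN => hsoc₂ k N hN)) (hsoc₁ k)
  have hrad : ∀ k ≤ r, radSeries R M k = F (r - k) := by
    intro k
    induction k with
    | zero => intro _; rw [Nat.sub_zero, hr]; rfl
    | succ k ih =>
      intro hk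
      obtain ⟨t, ht⟩ : ∃ t, r - k = t + 1 := ⟨r - k - 1, by omega⟩
      rw [radSeries, map_subtype_jacobson, ih (by omega), ht, show r - (k + 1) = t by omega]
      exact le_antisymm (hrad₂ t (by omega))
        (le_inf (hmono t.le_succ) (le_sInf fun N hN => hrad₁ t (by omega) N hN))
  refine ⟨r, ⟨by rw [Set.mem_ofPred_eq, hsoc, hr], fun k hk => ?_⟩, fun k hk => ?_⟩
  · by_contra h
    exact hlt k (not_le.1 h) (by rw [← hsoc]; exact hk)
  · rw [hrad _ (Nat.sub_le _ _), hsoc, Nat.sub_sub_self hk]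

end Filtrations

/-! ### Coefficients of the action, vanishing of `q`-integers, and weights -/

section Coefficients

variable {K : Type*} [Field K] {m n : ℕ} {q : K}

theorem mon_coe (a : Expo m n) : mon m n q a.1 = Finsupp.single a 1 := by
  rw [mon_eq_monZ, monZ_coe]

theorem moveOp_single_apply {i j : Fin (m + n)} (hij : i ≠ j) (b a' : Expo m n) (c : K) :
    moveOp m n q i j (Finsupp.single b c) a' =
      open Classical in
      if 1 ≤ b.1 j ∧ a'.1 = mv i j b.1 then qInt q (b.1 i + 1) * c else 0 := by
  classical
  simp only [moveOp, Finsupp.lsum_single, LinearMap.toSpanSingleton_apply]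
  by_cases h0 : b.1 j = 0
  · rw [if_pos h0, if_neg (by omega), smul_zero, Finsupp.zero_apply]
  have he : b.1 - Pi.single j 1 + Pi.single i 1 = mv i j b.1 := by
    funext k
    simp only [mv, Pi.add_apply, Pi.sub_apply, Pi.single_apply]
    split_ifs <;> subst_vars <;> simp_all
  rw [if_neg h0, he, Finsupp.smul_apply, Finsupp.smul_apply]
  by_cases h2 : a'.1 = mv i j b.1
  · rw [if_pos ⟨by omega, h2⟩, ← h2, mon_coe, Finsupp.single_eq_same, smul_eq_mul, smul_eq_mul,
      mul_one, mul_comm]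
  · rw [if_neg fun h => h2 h.2]
    have h0 : mon m n q (mv i j b.1) a' = 0 := by
      rw [mon]
      split_ifs with h1
      · exact Finsupp.single_eq_of_ne fun e => h2 (congrArg Subtype.val e)
      · rfl
    rw [h0, smul_zero, smul_zero]

/-- A move is injective on the exponents with `a_j ≥ 1`, so a coefficient of the image comes from a
single coefficient of `v`. -/
theorem moveOp_apply {i j : Fin (m + n)} (hij : i ≠ j) {a a' : Expo m n} (hj : 1 ≤ a.1 j)
    (h : a'.1 = mv i j a.1) (v : Omega m n q) :
    moveOp m n q i j v a' = qInt q (a.1 i + 1) * v a := by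
  classical
  induction v using Finsupp.induction_linear with
  | zero => simp
  | add x y hx hy => rw [map_add, Finsupp.add_apply, hx, hy, Finsupp.add_apply, mul_add]
  | single b c =>
    rw [moveOp_single_apply hij, Finsupp.single_apply]
    by_cases hb : b = a
    · subst hb
      rw [if_pos ⟨hj, h⟩, if_pos rfl]
    · rw [if_neg, if_neg hb, mul_zero]
      rintro ⟨h1, h2⟩
      exact hb (Subtype.ext (by rw [← mv_mv_symm hij h1, ← h2, h, mv_mv_symm hij hj]))

theorem exists_of_moveOp_apply_ne {i j : Fin (m + n)} (hij : i ≠ j) {a' : Expo m n}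
    {v : Omega m n q} (hv : moveOp m n q i j v a' ≠ 0) :
    ∃ a : Expo m n, 1 ≤ a.1 j ∧ a'.1 = mv i j a.1 ∧ qInt q (a.1 i + 1) ≠ 0 ∧ v a ≠ 0 := by
  classical
  by_contra hc
  refine hv ?_
  by_cases h : ∃ a : Expo m n, 1 ≤ a.1 j ∧ a'.1 = mv i j a.1
  · obtain ⟨a, h1, h2⟩ := h
    rw [moveOp_apply hij h1 h2]
    by_contra h3
    exact hc ⟨a, h1, h2, left_ne_zero_of_mul h3, right_ne_zero_of_mul h3⟩
  · clear hv hc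
    induction v using Finsupp.induction_linear with
    | zero => simp
    | add x y hx hy => rw [map_add, Finsupp.add_apply, hx, hy, add_zero]
    | single b c => rw [moveOp_single_apply hij, if_neg fun h' => h ⟨b, h'⟩]

theorem diagOp_apply (i : Fin (m + n)) (c : K) (v : Omega m n q) (a : Expo m n) :
    diagOp m n q i c v a = c ^ a.1 i * v a := by
  classical
  induction v using Finsupp.induction_linear with
  | zero => simp
  | add x y hx hy => rw [map_add, Finsupp.add_apply, hx, hy, Finsupp.add_apply, mul_add]
  | single b d =>
    simp only [diagOp, Finsupp.lsum_single, LinearMap.toSpanSingleton_apply, mon_coe,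
      Finsupp.smul_apply, Finsupp.single_apply, smul_eq_mul]
    split_ifs with h
    · rw [h]; ring
    · simp

/-- Orthogonality of characters, for the projections onto the eigenspaces of `K_i`. -/
theorem geom_sum_eq_ite {z : K} {k : ℕ} (hz : z ^ k = 1) :
    ∑ t ∈ Finset.range k, z ^ t = open Classical in if z = 1 then (k : K) else 0 := by
  classical
  split_ifs with h
  · simp [h]
  · have := geom_sum_mul z k
    rw [hz, sub_self] at this
    exact (mul_eq_zero.1 this).resolve_right (sub_ne_zero.2 h)

theorem exists_genAct_eq_moveOp (q : K) {i j : Fin (m + n)}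
    (h : (i : ℕ) + 1 = j ∨ (j : ℕ) + 1 = i) : ∃ g, genAct m n q g = moveOp m n q i j := by
  rcases h with h | h
  · refine ⟨Gen.e ⟨i, by omega⟩, ?_⟩
    rw [genAct, show lo ⟨(i : ℕ), _⟩ = i from rfl, show hi ⟨(i : ℕ), _⟩ = j from Fin.ext h]
  · refine ⟨Gen.f ⟨j, by omega⟩, ?_⟩
    rw [genAct, show lo ⟨(j : ℕ), _⟩ = j from rfl, show hi ⟨(j : ℕ), _⟩ = i from Fin.ext h]

/-- As `q ≠ q⁻¹`, `[k] = 0` means `q^(2k) = 1`, so such `k` are the multiples of the least positive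
one. -/
theorem qInt_eq_zero_iff [CharZero K] (hl : 3 ≤ qChar q) (k : ℕ) :
    qInt q k = 0 ↔ qChar q ∣ k := by
  obtain ⟨hq, hq1⟩ := q_facts hl
  have hp : ∀ k : ℕ, qInt q k = 0 ↔ q ^ (2 * k) = 1 := by
    intro k
    have hk : q ^ k ≠ 0 := pow_ne_zero _ hq
    rw [← mul_eq_zero_iff_right hq1, qInt_mul hq, zpow_neg, zpow_natCast, sub_eq_zero, two_mul,
      pow_add, ← mul_eq_one_iff_eq_inv₀ hk]
  constructor
  · intro h
    by_contra hd
    have hr : q ^ (2 * (k % qChar q)) = 1 := by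
      have h1 := (hp k).1 h
      rw [← Nat.div_add_mod k (qChar q), mul_add, pow_add, ← mul_assoc, pow_mul,
        q_pow_two hq hl, one_pow, one_mul] at h1
      exact h1
    have h2 : qChar q ≤ k % qChar q := Nat.sInf_le
      ⟨Nat.pos_of_ne_zero fun h => hd (Nat.dvd_of_mod_eq_zero h), (hp _).2 hr⟩
    have := Nat.mod_lt k (show 0 < qChar q by omega)
    omega
  · rintro ⟨t, rfl⟩
    rw [qInt_eq_qz hq hq1]
    have := qz_mul_char hq hl t
    exact_mod_cast this

/-- Two exponents whose monomials have the same weight. -/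
def SameWt (q : K) (a b : Expo m n) : Prop :=
  ∀ i : Fin (m + n), qi m q i ^ a.1 i = qi m q i ^ b.1 i

/-- Only this implication holds in general: `q^ℓ` may be `-1`, and then congruence modulo `ℓ` does
not give equal powers. -/
theorem dvd_sub_of_pow_eq [CharZero K] (hl : 3 ≤ qChar q) {x y : ℕ} (h : q ^ x = q ^ y)
    (hxy : y ≤ x) : qChar q ∣ x - y := by
  obtain ⟨hq, hq1⟩ := q_facts hl
  rw [← qInt_eq_zero_iff hl]
  have h1 : q ^ (x - y) = 1 := by
    have := pow_ne_zero y hq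
    rw [← Nat.sub_add_cancel hxy, pow_add] at h
    exact mul_right_cancel₀ this (by rw [h, one_mul])
  refine (mul_eq_zero_iff_right hq1).1 ?_
  rw [qInt_mul hq, zpow_neg, zpow_natCast, h1, inv_one, sub_self]

theorem SameWt.modEq [CharZero K] (hl : 3 ≤ qChar q) {a b : Expo m n} (h : SameWt q a b)
    {i : Fin (m + n)} (hi : (i : ℕ) < m) : a.1 i ≡ b.1 i [MOD qChar q] := by
  have h1 := h i
  rw [qi, if_pos hi] at h1
  rcases le_total (a.1 i) (b.1 i) with h2 | h2
  · exact (Nat.modEq_iff_dvd' h2).2 (dvd_sub_of_pow_eq hl h1.symm h2)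
  · exact ((Nat.modEq_iff_dvd' h2).2 (dvd_sub_of_pow_eq hl h1 h2)).symm

/-- An odd entry is `0` or `1`, and `q⁻¹ ≠ 1` separates the two. -/
theorem SameWt.eq_of_odd [CharZero K] (hl : 3 ≤ qChar q) {a b : Expo m n} (h : SameWt q a b)
    {i : Fin (m + n)} (hi : m ≤ (i : ℕ)) : a.1 i = b.1 i := by
  obtain ⟨hq, hq1⟩ := q_facts hl
  have hne : q⁻¹ ≠ 1 := fun e => hq1 (by rw [e, inv_eq_one.1 e, sub_self])
  have h1 := h i
  rw [qi, if_neg (not_lt.2 hi)] at h1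
  have ha := a.2 i hi
  have hb := b.2 i hi
  interval_cases a.1 i <;> interval_cases b.1 i <;> simp_all

theorem SameWt.res_eq [CharZero K] (hl : 3 ≤ qChar q) {a b : Expo m n} (h : SameWt q a b)
    (i : Fin (m + n)) : res m (qChar q) i (a.1 i) = res m (qChar q) i (b.1 i) := by
  unfold res
  split_ifs with hi
  · exact h.modEq hl hi
  · exact h.eq_of_odd hl (not_lt.1 hi)

/-- Equal weights give equal residues, and in fixed degree the residues determine the energy. Hence
taking a weight component never mixes energy levels. -/
theorem SameWt.energy_eq [CharZero K] (hl : 3 ≤ qChar q) {a b : Expo m n} (h : SameWt q a b)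
    (hs : ∑ i, a.1 i = ∑ i, b.1 i) : energy (qChar q) a = energy (qChar q) b := by
  have h1 := sum_eq_energy (qChar q) a
  have h2 := sum_eq_energy (qChar q) b
  rw [Finset.sum_congr rfl fun i _ => h.res_eq hl i] at h1
  have h3 : qChar q * energy (qChar q) a = qChar q * energy (qChar q) b := by omega
  exact Nat.eq_of_mul_eq_mul_left (by omega) h3

theorem SameWt.qInt_eq [CharZero K] (hl : 3 ≤ qChar q) {a b : Expo m n} (h : SameWt q a b)
    (i : Fin (m + n)) : qInt q (a.1 i + 1) = qInt q (b.1 i + 1) := by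
  obtain ⟨hq, hq1⟩ := q_facts hl
  by_cases hi : (i : ℕ) < m
  · have h1 := h i
    rw [qi, if_pos hi] at h1
    apply mul_right_cancel₀ hq1
    rw [qInt_mul hq, qInt_mul hq, zpow_neg, zpow_neg, zpow_natCast, zpow_natCast, pow_succ,
      pow_succ, h1]
  · rw [h.eq_of_odd hl (not_lt.1 hi)]

end Coefficients

/-! ### Submodules, monomials and weight components -/

section Submodules

variable {K : Type*} [Field K] [CharZero K] {m n : ℕ} {q : K} [hl : Fact (3 ≤ qChar q)] {s : ℕ}

theorem mem_homog_iff {v : Omega m n q} :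
    v ∈ homog m n q s ↔ ∀ a : Expo m n, v a ≠ 0 → ∑ i, a.1 i = s := by
  have : v ∈ homog m n q s ↔ v ∈ Finsupp.supported K K {a : Expo m n | ∑ i, a.1 i = s} := by
    rw [Finsupp.supported_eq_span_single]
    change v ∈ Submodule.span K _ ↔ _
    have e : {w : Omega m n q | ∃ a : Expo m n, ∑ i, a.1 i = s ∧ w = Finsupp.single a 1} =
        (fun a => Finsupp.single a (1 : K)) '' {a : Expo m n | ∑ i, a.1 i = s} := by
      ext w
      constructor
      · rintro ⟨a, h, rfl⟩; exact ⟨a, h, rfl⟩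
      · rintro ⟨a, h, rfl⟩; exact ⟨a, h, rfl⟩
    rw [e]
  rw [this, Finsupp.mem_supported']
  exact ⟨fun h a ha => by by_contra hc; exact ha (h a hc),
    fun h a ha => by by_contra hc; exact ha (h a hc)⟩

/-- The action of a generator on a homogeneous component. -/
theorem coe_gen_smul (g : Gen m n) (v : homog m n q s) :
    ((toSmallU m n q (FreeAlgebra.ι K g) • v : homog m n q s) : Omega m n q) =
      genAct m n q g v := by
  rw [Submodule.coe_smul, toSmallU_smul, FreeAlgebra.lift_ι_apply]

/-- Submodules here are over `SmallU` alone, so scalars of `K` enter as elements of that algebra. -/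
theorem coe_algebraMap_smul (c : K) (v : homog m n q s) :
    ((toSmallU m n q (algebraMap K _ c) • v : homog m n q s) : Omega m n q) =
      c • (v : Omega m n q) := by
  rw [Submodule.coe_smul, toSmallU_smul, AlgHom.commutes]
  rfl

/-- A set of exponents that is closed under `Step`. -/
def StepClosed (l : ℕ) (X : Set (Expo m n)) : Prop := ∀ a a', Step l a a' → a ∈ X → a' ∈ X

theorem StepClosed.reach {l : ℕ} {X : Set (Expo m n)} (hX : StepClosed l X) {a a' : Expo m n}
    (h : Reach l a a') (ha : a ∈ X) : a' ∈ X := by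
  induction h with
  | refl => exact ha
  | tail _ h ih => exact hX _ _ h ih

theorem genAct_supported {X : Set (Expo m n)} (hX : StepClosed (qChar q) X) (g : Gen m n)
    {v : Omega m n q} (hv : ∀ a, v a ≠ 0 → a ∈ X) (a' : Expo m n)
    (ha' : genAct m n q g v a' ≠ 0) : a' ∈ X := by
  have hmove : ∀ {i j : Fin (m + n)}, (i : ℕ) + 1 = j ∨ (j : ℕ) + 1 = i →
      moveOp m n q i j v a' ≠ 0 → a' ∈ X := by
    intro i j hij h
    obtain ⟨a, h1, h2, h3, h4⟩ := exists_of_moveOp_apply_ne (fin_ne (by omega)) h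
    exact hX a a' ⟨i, j, hij, h1, fun hd => h3 ((qInt_eq_zero_iff hl.out _).2 hd), h2⟩ (hv a h4)
  cases g with
  | e j => exact hmove (Or.inl rfl) ha'
  | f j => exact hmove (Or.inr rfl) ha'
  | k i =>
    rw [genAct, diagOp_apply] at ha'
    exact hv a' (right_ne_zero_of_mul ha')
  | kinv i =>
    rw [genAct, diagOp_apply] at ha'
    exact hv a' (right_ne_zero_of_mul ha')

/-- The submodule of the vectors of degree `s` that are supported on a closed set of exponents. -/
def supportedOn (q : K) [hl : Fact (3 ≤ qChar q)] (s : ℕ) (X : Set (Expo m n))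
    (hX : StepClosed (qChar q) X) : Submodule (SmallU m n q) (homog m n q s) where
  carrier := {v | ∀ a, (v : Omega m n q) a ≠ 0 → a ∈ X}
  add_mem' {v w} hv hw a ha := by
    by_cases h : (v : Omega m n q) a = 0
    · refine hw a fun h' => ha ?_
      rw [Submodule.coe_add, Finsupp.add_apply, h, h', add_zero]
    · exact hv a h
  zero_mem' a ha := absurd rfl ha
  smul_mem' u v hv := by
    obtain ⟨x, rfl⟩ := toSmallU_surjective m n q u
    rw [Set.mem_ofPred_eq, Submodule.coe_smul, toSmallU_smul]
    have key : ∀ w : Omega m n q, (∀ a, w a ≠ 0 → a ∈ X) →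
        ∀ a, FreeAlgebra.lift K (genAct m n q) x w a ≠ 0 → a ∈ X := by
      induction x using FreeAlgebra.induction with
      | grade0 r =>
        intro w hw a ha
        rw [AlgHom.commutes] at ha
        exact hw a (right_ne_zero_of_mul ha)
      | grade1 g =>
        intro w hw a ha
        rw [FreeAlgebra.lift_ι_apply] at ha
        exact genAct_supported hX g hw a ha
      | mul x y hx hy =>
        intro w hw
        rw [map_mul, Module.End.mul_apply]
        exact hx _ (hy w hw)
      | add x y hx hy =>
        intro w hw a ha
        rw [map_add, LinearMap.add_apply, Finsupp.add_apply] at ha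
        by_cases h : FreeAlgebra.lift K (genAct m n q) x w a = 0
        · exact hy w hw a fun h' => ha (by rw [h, h', add_zero])
        · exact hx w hw a h
    exact key v hv

theorem mem_supportedOn {X : Set (Expo m n)} {hX : StepClosed (qChar q) X}
    {v : homog m n q s} :
    v ∈ supportedOn q s X hX ↔ ∀ a, (v : Omega m n q) a ≠ 0 → a ∈ X := Iff.rfl

/-- The monomial `x^a`, as an element of the component of degree `s`; it is `0` if `a` has another
degree. -/
noncomputable def monoAt (q : K) [hl : Fact (3 ≤ qChar q)] (s : ℕ) (a : Expo m n) :
    homog m n q s :=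
  if h : ∑ i, a.1 i = s then ⟨Finsupp.single a 1, mem_homog_iff.2 fun b hb => by
    rw [Finsupp.single_apply_ne_zero] at hb
    rw [hb.1, h]⟩ else 0

theorem coe_monoAt {a : Expo m n} (h : ∑ i, a.1 i = s) :
    (monoAt q s a : Omega m n q) = Finsupp.single a 1 := by
  rw [monoAt, dif_pos h]

theorem sum_eq_of_apply_ne (v : homog m n q s) {a : Expo m n} (h : (v : Omega m n q) a ≠ 0) :
    ∑ i, a.1 i = s := mem_homog_iff.1 v.2 a h

/-- A submodule that contains the monomials of the support of `v` contains `v`. -/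
theorem mem_of_monoAt_mem {N : Submodule (SmallU m n q) (homog m n q s)} {v : homog m n q s}
    (h : ∀ a, (v : Omega m n q) a ≠ 0 → monoAt q s a ∈ N) : v ∈ N := by
  have e : v = ∑ a ∈ (v : Omega m n q).support,
      toSmallU m n q (algebraMap K _ ((v : Omega m n q) a)) • monoAt q s a := by
    apply Subtype.ext
    rw [Submodule.coe_sum]
    conv_lhs => rw [← Finsupp.sum_single (v : Omega m n q), Finsupp.sum]
    refine Finset.sum_congr rfl fun a ha => ?_
    rw [coe_algebraMap_smul, coe_monoAt (sum_eq_of_apply_ne v (Finsupp.mem_support_iff.1 ha)),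
      Finsupp.smul_single, smul_eq_mul, mul_one]
  rw [e]
  exact Submodule.sum_mem _ fun a ha => N.smul_mem _ (h a (Finsupp.mem_support_iff.1 ha))

theorem gen_smul_monoAt {i j : Fin (m + n)} (hij : i ≠ j) {g : Gen m n}
    (hg : genAct m n q g = moveOp m n q i j) {a a' : Expo m n} (hj : 1 ≤ a.1 j)
    (h : a'.1 = mv i j a.1) :
    toSmallU m n q (FreeAlgebra.ι K g) • monoAt q s a =
      toSmallU m n q (algebraMap K _ (qInt q (a.1 i + 1))) • monoAt q s a' := by
  classical
  have hs : ∑ i, a'.1 i = ∑ i, a.1 i := by rw [h, sum_mv_id hij hj]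
  by_cases ha : ∑ i, a.1 i = s
  · apply Subtype.ext
    rw [coe_gen_smul, coe_algebraMap_smul, coe_monoAt ha, coe_monoAt (hs.trans ha), hg]
    ext b
    rw [moveOp_single_apply hij, Finsupp.smul_apply, Finsupp.single_apply, smul_eq_mul]
    by_cases hb : a' = b
    · subst hb
      rw [if_pos ⟨hj, h⟩, if_pos rfl]
    · rw [if_neg fun h' => hb (Subtype.ext (h.trans h'.2.symm)), if_neg hb, mul_zero]
  · rw [monoAt, dif_neg ha, monoAt, dif_neg (by omega), smul_zero, smul_zero]

theorem gen_smul_monoAt_eq_zero {i j : Fin (m + n)} (hij : i ≠ j) {g : Gen m n}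
    (hg : genAct m n q g = moveOp m n q i j) {a : Expo m n} (hj : a.1 j = 0) :
    toSmallU m n q (FreeAlgebra.ι K g) • monoAt q s a = 0 := by
  classical
  by_cases ha : ∑ i, a.1 i = s
  · apply Subtype.ext
    rw [coe_gen_smul, coe_monoAt ha, hg]
    ext b
    rw [moveOp_single_apply hij, if_neg (by omega)]
    rfl
  · rw [monoAt, dif_neg ha, smul_zero]

theorem algebraMap_smul_mem_iff {N : Submodule (SmallU m n q) (homog m n q s)}
    {v : homog m n q s} {c : K} (hc : c ≠ 0) :
    toSmallU m n q (algebraMap K _ c) • v ∈ N ↔ v ∈ N := by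
  refine ⟨fun h => ?_, fun h => N.smul_mem _ h⟩
  have := N.smul_mem (toSmallU m n q (algebraMap K _ c⁻¹)) h
  rwa [smul_smul, ← map_mul, ← map_mul, inv_mul_cancel₀ hc, map_one, map_one, one_smul] at this

/-- The exponents of the monomials in a submodule. -/
theorem stepClosed_monoAt_mem (N : Submodule (SmallU m n q) (homog m n q s)) :
    StepClosed (qChar q) {a : Expo m n | monoAt q s a ∈ N} := by
  rintro a a' ⟨i, j, hij, hj, hi, h⟩ ha
  obtain ⟨g, hg⟩ := exists_genAct_eq_moveOp q hij
  have := N.smul_mem (toSmallU m n q (FreeAlgebra.ι K g)) ha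
  rw [gen_smul_monoAt (fin_ne (by omega)) hg hj h] at this
  exact (algebraMap_smul_mem_iff fun h0 => hi ((qInt_eq_zero_iff hl.out _).1 h0)).1 this

/-- The exponents that occur in the vectors of a submodule. -/
theorem stepClosed_exists_apply_ne (N : Submodule (SmallU m n q) (homog m n q s)) :
    StepClosed (qChar q) {a : Expo m n | ∃ v ∈ N, (v : Omega m n q) a ≠ 0} := by
  rintro a a' ⟨i, j, hij, hj, hi, h⟩ ⟨v, hv, hva⟩
  obtain ⟨g, hg⟩ := exists_genAct_eq_moveOp q hij
  refine ⟨_, N.smul_mem (toSmallU m n q (FreeAlgebra.ι K g)) hv, ?_⟩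
  rw [coe_gen_smul, hg, moveOp_apply (fin_ne (by omega)) hj h]
  exact mul_ne_zero (fun h0 => hi ((qInt_eq_zero_iff hl.out _).1 h0)) hva

/-- A submodule contains the weight components of its vectors. -/
theorem exists_weight_component {N : Submodule (SmallU m n q) (homog m n q s)}
    {v : homog m n q s} (hv : v ∈ N) (a : Expo m n) :
    ∃ w ∈ N, (∀ b, SameWt q b a → (w : Omega m n q) b = (v : Omega m n q) b) ∧
      ∀ b, ¬ SameWt q b a → (w : Omega m n q) b = 0 := by
  classical
  obtain ⟨hq, hq1⟩ := q_facts hl.out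
  have hl0 : 3 ≤ qChar q := hl.out
  -- The eigenvalue conditions are imposed one index at a time.
  have key : ∀ S : Finset (Fin (m + n)), ∃ w ∈ N, ∀ b : Expo m n, (w : Omega m n q) b =
      if ∀ i ∈ S, qi m q i ^ b.1 i = qi m q i ^ a.1 i then (v : Omega m n q) b else 0 := by
    intro S
    induction S using Finset.induction_on with
    | empty => exact ⟨v, hv, fun b => by simp⟩
    | insert i S hi ih =>
      obtain ⟨w, hw, hwb⟩ := ih
      set c := qi m q i with hc
      have hc0 : c ≠ 0 := qi_ne hq m i
      have hc1 : c ^ (2 * qChar q) = 1 := by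
        rw [hc, qi]
        split_ifs
        · exact q_pow_two hq hl0
        · rw [inv_pow, q_pow_two hq hl0, inv_one]
      -- This is `2ℓ` times the projector onto the eigenvalue `c^(a_i)` of `K_i`, since `K_i^(2ℓ) =
      -- 1`; characteristic `0` allows division by `2ℓ`.
      set u := ∑ t ∈ Finset.range (2 * qChar q),
        toSmallU m n q (algebraMap K _ ((c ^ a.1 i)⁻¹ ^ t) * FreeAlgebra.ι K (Gen.k i) ^ t)
      refine ⟨toSmallU m n q (algebraMap K _ ((2 * qChar q : ℕ) : K)⁻¹) • u • w,
        N.smul_mem _ (N.smul_mem _ hw), fun b => ?_⟩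
      have hpow : ∀ (t : ℕ) (x : Omega m n q),
          ((diagOp m n q i c) ^ t) x b = (c ^ b.1 i) ^ t * x b := by
        intro t
        induction t with
        | zero => intro x; simp
        | succ t iht =>
          intro x
          rw [pow_succ, Module.End.mul_apply, iht, diagOp_apply, pow_succ, mul_assoc]
      have hu : ((u • w : homog m n q s) : Omega m n q) b =
          (∑ t ∈ Finset.range (2 * qChar q), ((c ^ a.1 i)⁻¹ * c ^ b.1 i) ^ t) *
            (w : Omega m n q) b := by
        rw [Finset.sum_smul, Submodule.coe_sum, Finsupp.finsetSum_apply, Finset.sum_mul]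
        refine Finset.sum_congr rfl fun t _ => ?_
        rw [Submodule.coe_smul, toSmallU_smul, map_mul, map_pow _ (FreeAlgebra.ι K _), AlgHom.commutes,
          FreeAlgebra.lift_ι_apply, genAct, Module.End.mul_apply, Module.algebraMap_end_apply,
          Finsupp.smul_apply, hpow, smul_eq_mul, mul_pow, mul_assoc]
      have hz : ((c ^ a.1 i)⁻¹ * c ^ b.1 i) ^ (2 * qChar q) = 1 := by
        rw [mul_pow, inv_pow, pow_right_comm c, hc1, one_pow, pow_right_comm c, hc1, one_pow,
          inv_one, one_mul]
      have hz1 : (c ^ a.1 i)⁻¹ * c ^ b.1 i = 1 ↔ c ^ b.1 i = c ^ a.1 i := by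
        rw [inv_mul_eq_one₀ (pow_ne_zero _ hc0), eq_comm]
      have hN : ((2 * qChar q : ℕ) : K) ≠ 0 := Nat.cast_ne_zero.2 (by omega)
      rw [coe_algebraMap_smul, Finsupp.smul_apply, hu, geom_sum_eq_ite hz, hwb b, hz1]
      simp only [Finset.forall_mem_insert]
      by_cases h1 : c ^ b.1 i = c ^ a.1 i
      · by_cases h2 : ∀ j ∈ S, qi m q j ^ b.1 j = qi m q j ^ a.1 j
        · rw [if_pos h1, if_pos h2, if_pos ⟨h1, h2⟩, smul_eq_mul, inv_mul_cancel_left₀ hN]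
        · rw [if_neg h2, mul_zero, smul_zero, if_neg]
          exact fun h => h2 h.2
      · rw [if_neg h1, zero_mul, smul_zero, if_neg]
        exact fun h => h1 h.1
  obtain ⟨w, hw, hwb⟩ := key Finset.univ
  refine ⟨w, hw, fun b hb => ?_, fun b hb => ?_⟩
  · rw [hwb, if_pos fun i _ => hb i]
  · rw [hwb, if_neg fun h => hb fun i => h i (Finset.mem_univ i)]

end Submodules

/-! ### Range of the energy in a fixed degree, and passage between levels -/

section EnergyFiltration

variable {m n : ℕ}

theorem Step.div_le {l : ℕ} {a a' : Expo m n} (h : Step l a a') (k : Fin (m + n)) :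
    a'.1 k / l ≤ a.1 k / l := by
  obtain ⟨i, j, hij, -, hi, h⟩ := h
  rw [h]
  by_cases hki : k = i
  · subst hki
    rw [mv_left, (succ_mod_div hi).1]
  · refine Nat.div_le_div_right ?_
    simp only [mv, if_neg hki]
    split_ifs with hkj
    · rw [hkj]; exact Nat.sub_le _ _
    · exact le_rfl

/-- No quotient rises along a step, so equality of the sums forces equality termwise: a step that
leaves a cell strictly loses energy. -/
theorem Step.div_eq_of_energy_le {l : ℕ} {a a' : Expo m n} (h : Step l a a')
    (he : energy l a ≤ energy l a') (k : Fin (m + n)) (hk : (k : ℕ) < m) :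
    a'.1 k / l = a.1 k / l := by
  have hle : ∀ k ∈ (Finset.univ : Finset (Fin (m + n))),
      (if (k : ℕ) < m then a'.1 k / l else 0) ≤ if (k : ℕ) < m then a.1 k / l else 0 := fun k _ => by
    split_ifs
    · exact h.div_le k
    · exact le_rfl
  have := (Finset.sum_eq_sum_iff_of_le hle).1 (le_antisymm (Finset.sum_le_sum hle) he) k
    (Finset.mem_univ k)
  simpa only [if_pos hk] using this

/-- The least energy of an exponent of degree `s`. -/
noncomputable def minEnergy (m n l s : ℕ) : ℕ :=
  sInf {E | s ≤ ∑ i : Fin (m + n), resMax m l i + l * E}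

theorem minEnergy_le {l : ℕ} (hl : 3 ≤ l) (a : Expo m n) :
    minEnergy m n l (∑ i, a.1 i) ≤ energy l a := by
  refine Nat.sInf_le ?_
  rw [Set.mem_ofPred_eq, sum_eq_energy l a, add_comm]
  exact Nat.add_le_add_right (Finset.sum_le_sum fun i _ => res_le_resMax (by omega) a i) _

theorem energy_le_div {l : ℕ} (hl : 3 ≤ l) (a : Expo m n) :
    energy l a ≤ (∑ i, a.1 i) / l := by
  rw [Nat.le_div_iff_mul_le (by omega), sum_eq_energy l a, mul_comm]
  exact Nat.le_add_right _ _

/-- The whole degree is put into the even entry `0`. With `energy_le_div` this makes `s / l` the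
maximal energy. -/
theorem exists_energy_eq_div (hm : 0 < m) (l s : ℕ) :
    ∃ a : Expo m n, ∑ i, a.1 i = s ∧ energy l a = s / l := by
  set z : Fin (m + n) := ⟨0, by omega⟩
  refine ⟨⟨Pi.single z s, fun i hi => ?_⟩, ?_, ?_⟩
  · rw [Pi.single_eq_of_ne (fin_ne (show (i : ℕ) ≠ 0 by omega))]
    exact Nat.zero_le _
  · simp
  · refine (Finset.sum_eq_single z (fun i _ hi => ?_) (by simp)).trans ?_
    · simp [hi]
    · rw [if_pos hm]
      simp

/-- Descent one level at a time; any even entry that is at least `l` can serve to lose a quotient.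
-/
theorem exists_reach_energy_eq {l : ℕ} (hl : 3 ≤ l) (d : ℕ) : ∀ a : Expo m n,
    minEnergy m n l (∑ i, a.1 i) + d ≤ energy l a →
    ∃ a', Reach l a a' ∧ energy l a = energy l a' + d := by
  induction d with
  | zero => intro a _; exact ⟨a, .refl, rfl⟩
  | succ d ih =>
    intro a ha
    obtain ⟨j, hjm, hj⟩ : ∃ j : Fin (m + n), (j : ℕ) < m ∧ l ≤ a.1 j := by
      by_contra hc
      have : energy l a = 0 := Finset.sum_eq_zero fun i _ => by
        split_ifs with hi
        · exact Nat.div_eq_of_lt (not_le.1 fun h => hc ⟨i, hi, h⟩)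
        · rfl
      omega
    have hmem : ∑ i, a.1 i ≤ ∑ i : Fin (m + n), resMax m l i +
        l * minEnergy m n l (∑ i, a.1 i) :=
      Nat.sInf_mem (s := {E | ∑ i, a.1 i ≤ ∑ i : Fin (m + n), resMax m l i + l * E})
        ⟨∑ i, a.1 i, by
          rw [Set.mem_ofPred_eq]
          have := Nat.le_mul_of_pos_left (∑ i, a.1 i) (show 0 < l by omega)
          omega⟩
    -- An energy above the minimum forces the residues to fall short of their maximal total by at
    -- least `l`, which is what a descent requires.
    have hE : l * (minEnergy m n l (∑ i, a.1 i) + 1) ≤ l * energy l a :=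
      Nat.mul_le_mul_left _ (by omega)
    have hs := sum_eq_energy l a
    rw [mul_add, mul_one] at hE
    obtain ⟨b, hb, hb'⟩ := exists_reach_energy_pred hl hjm _ a rfl hj (by omega)
    obtain ⟨c, hc, hc'⟩ := ih b (by rw [hb.sum_eq]; omega)
    exact ⟨c, hb.trans hc, by omega⟩

/-- Ascent against the edges, one level at a time, through entry `0`. The hypothesis says that the
target level is at most `s / l`, where `s` is the degree. -/
theorem exists_energy_eq_reach {l : ℕ} (hl : 3 ≤ l) (hm : 0 < m) (d : ℕ) : ∀ a : Expo m n,
    l * (energy l a + d) ≤ ∑ i, a.1 i →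
    ∃ a', Reach l a' a ∧ energy l a' = energy l a + d := by
  induction d with
  | zero => intro a _; exact ⟨a, .refl, rfl⟩
  | succ d ih =>
    intro a ha
    have hlt := Nat.mod_lt (a.1 ⟨0, by omega⟩) (show 0 < l by omega)
    obtain ⟨b, hb, hb'⟩ := exists_reach_energy_succ hl (j := ⟨0, by omega⟩) hm
      (l - 1 - a.1 ⟨0, by omega⟩ % l) a (by omega)
      (le_trans (Nat.mul_le_mul_left _ (by omega)) ha)
    obtain ⟨c, hc, hc'⟩ := ih b (by
      rw [hb', ← hb.sum_eq, add_assoc, add_comm 1 d]; exact ha)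
    exact ⟨c, hc.trans hb, by omega⟩

theorem stepClosed_energy_lt (l E : ℕ) : StepClosed l {a : Expo m n | energy l a < E} :=
  fun _ _ h ha => lt_of_le_of_lt h.energy_le ha

theorem energy_eq_of_div_eq {l : ℕ} {a b : Expo m n}
    (h : ∀ i : Fin (m + n), (i : ℕ) < m → a.1 i / l = b.1 i / l) : energy l a = energy l b :=
  Finset.sum_congr rfl fun i _ => by
    split_ifs with hi
    · exact h i hi
    · rfl

end EnergyFiltration

/-! ### The energy filtration is both the socle and the radical series -/

section Rigidity

variable {K : Type*} [Field K] [CharZero K] {m n : ℕ} {q : K} [hl : Fact (3 ≤ qChar q)] {s : ℕ}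

theorem supportedOn_mono {X Y : Set (Expo m n)} (hX : StepClosed (qChar q) X)
    (hY : StepClosed (qChar q) Y) (h : X ⊆ Y) : supportedOn q s X hX ≤ supportedOn q s Y hY :=
  fun _ hv a ha => h (hv a ha)

theorem coe_monoAt_apply_ne {a b : Expo m n} (h : (monoAt q s a : Omega m n q) b ≠ 0) :
    b = a := by
  by_cases ha : ∑ i, a.1 i = s
  · rw [coe_monoAt ha, Finsupp.single_apply_ne_zero] at h
    exact h.1
  · rw [monoAt, dif_neg ha] at h
    exact absurd rfl h

theorem monoAt_mem_supportedOn {X : Set (Expo m n)} (hX : StepClosed (qChar q) X) {a : Expo m n}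
    (ha : a ∈ X) : monoAt q s a ∈ supportedOn q s X hX := fun b hb => by
  rwa [coe_monoAt_apply_ne hb]

/-- Adding the exponents with given quotients to a closed set gives a maximal extension. -/
theorem supportedOn_covBy {X Y : Set (Expo m n)} (hX : StepClosed (qChar q) X)
    (hY : StepClosed (qChar q) Y) (hXY : X ⊆ Y) {a₀ : Expo m n} (ha₀ : ∑ i, a₀.1 i = s)
    (h₀Y : a₀ ∈ Y) (h₀X : a₀ ∉ X)
    (hcell : ∀ a ∈ Y, a ∉ X → ∀ i : Fin (m + n), (i : ℕ) < m →
      a.1 i / qChar q = a₀.1 i / qChar q) :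
    supportedOn q s X hX ⋖ supportedOn q s Y hY := by
  refine ⟨lt_of_le_not_ge (supportedOn_mono hX hY hXY) fun h => h₀X ?_, fun N hXN hNY => ?_⟩
  · refine h (monoAt_mem_supportedOn hY h₀Y) a₀ ?_
    rw [coe_monoAt ha₀, Finsupp.single_eq_same]
    exact one_ne_zero
  · obtain ⟨v, hvN, hvX⟩ := Set.exists_of_ssubset hXN
    obtain ⟨a, hva, haX⟩ : ∃ a, (v : Omega m n q) a ≠ 0 ∧ a ∉ X := by
      by_contra hc
      exact hvX fun a ha => by by_contra h; exact hc ⟨a, ha, h⟩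
    have haY : a ∈ Y := hNY.le hvN a hva
    have has := sum_eq_of_apply_ne v hva
    obtain ⟨w, hwN, hw₁, hw₂⟩ := exists_weight_component hvN a
    have hwa : (w : Omega m n q) a = (v : Omega m n q) a := hw₁ a fun _ => rfl
    set c := (v : Omega m n q) a
    have hmem : monoAt q s a ∈ N := by
      rw [← algebraMap_smul_mem_iff hva]
      -- `y` is `w` without its `x^a` term. Its exponents lie in `X`: those outside `X` would share
      -- both quotients and weight with `a`, hence equal `a`.
      set y := w + toSmallU m n q (algebraMap K _ (-c)) • monoAt q s a with hy
      have hyb : ∀ b, (y : Omega m n q) b =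
          (w : Omega m n q) b - c * (Finsupp.single a 1 : Omega m n q) b := fun b => by
        rw [hy, Submodule.coe_add, coe_algebraMap_smul, coe_monoAt has, Finsupp.add_apply,
          Finsupp.smul_apply, smul_eq_mul, neg_mul, sub_eq_add_neg]
      have e : toSmallU m n q (algebraMap K _ c) • monoAt q s a =
          w + toSmallU m n q (algebraMap K _ (-1)) • y := by
        refine Subtype.ext (Finsupp.ext fun b => ?_)
        rw [Submodule.coe_add, coe_algebraMap_smul, coe_algebraMap_smul, coe_monoAt has,
          Finsupp.add_apply, Finsupp.smul_apply, Finsupp.smul_apply, hyb, smul_eq_mul, smul_eq_mul]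
        ring
      rw [e]
      refine N.add_mem hwN (N.smul_mem _ (hXN.le (mem_supportedOn.2 fun b hb => ?_)))
      by_contra hbX
      rw [hyb] at hb
      by_cases hba : b = a
      · rw [hba, Finsupp.single_eq_same, mul_one, hwa, sub_self] at hb
        exact hb rfl
      · rw [Finsupp.single_eq_of_ne hba, mul_zero, sub_zero] at hb
        have hwt : SameWt q b a := by
          by_contra h
          exact hb (hw₂ b h)
        have hbY : b ∈ Y := hNY.le hwN b hb
        refine hba (Subtype.ext (funext fun i => ?_))
        by_cases hi : (i : ℕ) < m
        · rw [← Nat.div_add_mod (b.1 i) (qChar q), ← Nat.div_add_mod (a.1 i) (qChar q),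
            hcell b hbY hbX i hi, hcell a haY haX i hi, hwt.modEq hl.out hi]
        · exact hwt.eq_of_odd hl.out (not_lt.1 hi)
    -- The monomial `x^a` reaches every other exponent of its cell, so `N` is everything.
    refine hNY.not_ge fun x hx => mem_of_monoAt_mem fun b hb => ?_
    by_cases hbX : b ∈ X
    · exact hXN.le (monoAt_mem_supportedOn hX hbX)
    · exact (stepClosed_monoAt_mem N).reach (reach_of_div_eq hl.out _ a le_rfl
        (has.trans (sum_eq_of_apply_ne x hb).symm)
        fun i hi => (hcell a haY haX i hi).trans (hcell b (hx b hb) hbX i hi).symm) hmem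

/-- The span of the monomials of degree `s` and energy less than `E`. -/
noncomputable def energyFiltration (m n : ℕ) (q : K) [hl : Fact (3 ≤ qChar q)] (s E : ℕ) :
    Submodule (SmallU m n q) (homog m n q s) :=
  supportedOn q s {a | energy (qChar q) a < E} (stepClosed_energy_lt _ E)

theorem energyFiltration_mono : Monotone (energyFiltration m n q s) := fun _ _ h =>
  supportedOn_mono _ _ fun _ ha => lt_of_lt_of_le ha h

theorem energyFiltration_succ_le (E : ℕ) : energyFiltration m n q s (E + 1) ≤
    energyFiltration m n q s E ⊔ sSup {N | energyFiltration m n q s E ⋖ N} := by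
  intro v hv
  refine mem_of_monoAt_mem fun a ha => ?_
  have has := sum_eq_of_apply_ne v ha
  by_cases haE : energy (qChar q) a < E
  · exact (le_sup_left : energyFiltration m n q s E ≤ _) (monoAt_mem_supportedOn _ haE)
  have haE' : energy (qChar q) a = E := by
    have : energy (qChar q) a < E + 1 := hv a ha
    omega
  -- The levels below `E` together with the cell of `a`: a step from the cell either stays in it or
  -- loses energy.
  have hY : StepClosed (qChar q) {b : Expo m n | energy (qChar q) b < E ∨
      ∀ i : Fin (m + n), (i : ℕ) < m → b.1 i / qChar q = a.1 i / qChar q} := by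
    rintro b b' h (hb | hb)
    · exact Or.inl (lt_of_le_of_lt h.energy_le hb)
    · by_cases he : energy (qChar q) b' < E
      · exact Or.inl he
      · refine Or.inr fun i hi => ?_
        rw [h.div_eq_of_energy_le (by rw [energy_eq_of_div_eq hb]; omega) i hi, hb i hi]
  have hcov : energyFiltration m n q s E ⋖ supportedOn q s _ hY :=
    supportedOn_covBy _ hY (fun b hb => Or.inl hb) has (Or.inr fun _ _ => rfl) haE
      fun b hb hb' => hb.resolve_left hb'
  exact (le_sup_of_le_right (le_sSup hcov) : supportedOn q s _ hY ≤ _)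
    (monoAt_mem_supportedOn hY (Or.inr fun _ _ => rfl))

/-- A term of energy at least `E` in a vector of `N` is carried down to energy exactly `E`, and the
weight component there has all its terms on that level. So `N` meets `F_{E+1}` outside `F_E`, and
the cover `N` then lies in `F_{E+1}`. -/
theorem le_energyFiltration_of_covBy {E : ℕ} (hE : minEnergy m n (qChar q) s ≤ E)
    {N : Submodule (SmallU m n q) (homog m n q s)} (hN : energyFiltration m n q s E ⋖ N) :
    N ≤ energyFiltration m n q s (E + 1) := by
  obtain ⟨v, hvN, hv⟩ := Set.exists_of_ssubset hN.1
  obtain ⟨a, hva, haE⟩ : ∃ a, (v : Omega m n q) a ≠ 0 ∧ E ≤ energy (qChar q) a := by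
    by_contra hc
    exact hv fun a ha => by
      by_contra h
      exact hc ⟨a, ha, not_lt.1 h⟩
  have has := sum_eq_of_apply_ne v hva
  obtain ⟨a', hr, he⟩ := exists_reach_energy_eq hl.out (energy (qChar q) a - E) a
    (by rw [has]; omega)
  obtain ⟨v', hv'N, hv'⟩ := (stepClosed_exists_apply_ne N).reach hr ⟨v, hvN, hva⟩
  obtain ⟨w, hwN, hw₁, hw₂⟩ := exists_weight_component hv'N a'
  have hwa : (w : Omega m n q) a' ≠ 0 := by rwa [hw₁ a' fun _ => rfl]
  have hwE : w ∈ energyFiltration m n q s (E + 1) := fun b hb => by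
    have hwt : SameWt q b a' := by
      by_contra h
      exact hb (hw₂ b h)
    have := hwt.energy_eq hl.out
      ((sum_eq_of_apply_ne w hb).trans (sum_eq_of_apply_ne w hwa).symm)
    rw [Set.mem_ofPred_eq]
    omega
  rcases hN.eq_or_eq (le_inf hN.le (energyFiltration_mono E.le_succ)) inf_le_left with h | h
  · have : w ∈ energyFiltration m n q s E := h ▸ ⟨hwN, hwE⟩
    have : energy (qChar q) a' < E := this a' hwa
    omega
  · exact inf_eq_left.1 h

/-- Otherwise `N + F_E = F_{E+1}`. Weights of level `E` do not occur in `F_E`, so weight components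
put every monomial of energy `E` into `N`; these monomials reach all those of lower energy, so `N`
contains `F_E` after all. -/
theorem energyFiltration_le_of_covBy (hm : 0 < m) {E : ℕ} (hE : E ≤ s / qChar q)
    {N : Submodule (SmallU m n q) (homog m n q s)} (hN : N ⋖ energyFiltration m n q s (E + 1)) :
    energyFiltration m n q s E ≤ N := by
  have hl0 : 3 ≤ qChar q := hl.out
  by_contra hle
  have hsup : N ⊔ energyFiltration m n q s E = energyFiltration m n q s (E + 1) := by
    rcases hN.eq_or_eq le_sup_left (sup_le hN.le (energyFiltration_mono E.le_succ)) with h | h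
    · exact absurd (sup_eq_left.1 h) hle
    · exact h
  have htop : ∀ a : Expo m n, ∑ i, a.1 i = s → energy (qChar q) a = E → monoAt q s a ∈ N := by
    intro a has haE
    have hmem : monoAt q s a ∈ energyFiltration m n q s (E + 1) :=
      monoAt_mem_supportedOn _ (show energy (qChar q) a < E + 1 by omega)
    rw [← hsup] at hmem
    obtain ⟨x, hx, y, hy, hxy⟩ := Submodule.mem_sup.1 hmem
    obtain ⟨w, hwN, hw₁, hw₂⟩ := exists_weight_component hx a
    have e : w = monoAt q s a := by
      refine Subtype.ext (Finsupp.ext fun b => ?_)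
      by_cases hwt : SameWt q b a
      · rw [hw₁ b hwt, ← hxy, Submodule.coe_add, Finsupp.add_apply]
        have : (y : Omega m n q) b = 0 := by
          by_contra h
          have h1 : energy (qChar q) b < E := hy b h
          have := hwt.energy_eq hl0 ((sum_eq_of_apply_ne y h).trans has.symm)
          omega
        rw [this, add_zero]
      · rw [hw₂ b hwt]
        by_contra h
        exact hwt (by rw [coe_monoAt_apply_ne (Ne.symm h)]; exact fun _ => rfl)
    rwa [← e]
  refine hle fun v hv => mem_of_monoAt_mem fun a ha => ?_
  have has := sum_eq_of_apply_ne v ha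
  have haE : energy (qChar q) a < E := hv a ha
  obtain ⟨a', hr, he⟩ := exists_energy_eq_reach hl0 hm (E - energy (qChar q) a) a (by
    rw [has, Nat.add_sub_cancel' haE.le, mul_comm]
    exact (Nat.le_div_iff_mul_le (by omega)).1 hE)
  exact (stepClosed_monoAt_mem N).reach hr (htop a' (hr.sum_eq.symm.trans has) (by omega))

/-- Removing a single cell of energy `E` from `F_{E+1}` leaves a maximal submodule, and the
intersection of these has no term of energy `E`. -/
theorem energyFiltration_inf_sInf_le (E : ℕ) : energyFiltration m n q s (E + 1) ⊓
    sInf {N | N ⋖ energyFiltration m n q s (E + 1)} ≤ energyFiltration m n q s E := by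
  rintro v ⟨hv, hv'⟩ a ha
  by_contra haE
  have haE₁ : energy (qChar q) a < E + 1 := hv a ha
  have haE₂ : ¬ energy (qChar q) a < E := haE
  have has := sum_eq_of_apply_ne v ha
  have hX : StepClosed (qChar q) {b : Expo m n | energy (qChar q) b < E + 1 ∧
      ¬ ∀ i : Fin (m + n), (i : ℕ) < m → b.1 i / qChar q = a.1 i / qChar q} := by
    rintro b b' h ⟨hb, hb'⟩
    refine ⟨lt_of_le_of_lt h.energy_le hb, fun hc => hb' fun i hi => ?_⟩
    rw [← h.div_eq_of_energy_le (by rw [energy_eq_of_div_eq hc]; omega) i hi, hc i hi]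
  have hcov : supportedOn q s _ hX ⋖ energyFiltration m n q s (E + 1) :=
    supportedOn_covBy hX _ (fun b hb => hb.1) has haE₁ (fun h => h.2 fun _ _ => rfl)
      fun b hb hb' => by
        by_contra hc
        exact hb' ⟨hb, hc⟩
  exact ((Submodule.mem_sInf.1 hv' _ hcov) a ha).2 fun _ _ => rfl

theorem isRigid_homog (hm : 0 < m) : IsRigid (SmallU m n q) (homog m n q s) := by
  have hl0 : 3 ≤ qChar q := hl.out
  obtain ⟨a₀, ha₀, he₀⟩ := exists_energy_eq_div (n := n) hm (qChar q) s
  have hmin : minEnergy m n (qChar q) s ≤ s / qChar q := by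
    have := minEnergy_le hl0 a₀
    rwa [ha₀, he₀] at this
  -- The index is shifted by the minimal energy so that the filtration starts at `0`; the length
  -- counts the levels from the minimal energy to `s / ℓ`.
  refine isRigid_of_filtration
    (fun k => energyFiltration m n q s (minEnergy m n (qChar q) s + k))
    (s / qChar q - minEnergy m n (qChar q) s + 1) ?_
    (fun _ _ h => energyFiltration_mono (Nat.add_le_add_left h _)) ?_ ?_
    (fun k => energyFiltration_succ_le _)
    (fun k N hN => le_energyFiltration_of_covBy (Nat.le_add_right _ _) hN)
    (fun k hk N hN => energyFiltration_le_of_covBy hm (by omega) hN)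
    (fun k _ => energyFiltration_inf_sInf_le _)
  · refine (Submodule.eq_bot_iff _).2 fun v hv => Subtype.ext (Finsupp.ext fun a => ?_)
    by_contra ha
    have h1 : energy (qChar q) a < minEnergy m n (qChar q) s := hv a ha
    have h2 := minEnergy_le hl0 a
    rw [sum_eq_of_apply_ne v ha] at h2
    omega
  · refine (Submodule.eq_top_iff').2 fun v a ha => ?_
    have h2 := energy_le_div hl0 a
    rw [sum_eq_of_apply_ne v ha] at h2
    rw [Set.mem_ofPred_eq]
    omega
  · intro k hk h
    have hmem : monoAt q s a₀ ∈ energyFiltration m n q s (minEnergy m n (qChar q) s + k) :=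
      h ▸ Submodule.mem_top
    have : energy (qChar q) a₀ < minEnergy m n (qChar q) s + k := hmem a₀ (by
      rw [coe_monoAt ha₀, Finsupp.single_eq_same]
      exact one_ne_zero)
    omega

end Rigidity

/-! ### A criterion for indecomposability by endomorphisms -/

section Indecomposability

/-- Apply the dichotomy to the projection onto `A` along `B`: the first case puts `X` into `B`, the
second puts it into `A`. -/
theorem isIndecomposable_of_endomorphisms {R M : Type*} [Ring R] [AddCommGroup M] [Module R M]
    (X : Set M) (hne : ∃ x ∈ X, x ≠ 0) (hX : ∀ N : Submodule R M, X ⊆ N → N = ⊤)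
    (h : ∀ φ : M →ₗ[R] M, (∀ x ∈ X, φ x = 0) ∨ ∀ x ∈ X, ∃ u : R, u • φ x = x) :
    IsIndecomposable R M := by
  obtain ⟨x, -, hx⟩ := hne
  refine ⟨⟨x, 0, hx⟩, fun A B hAB => ?_⟩
  rcases h (A.projection B hAB) with h | h
  · left
    have hB : B = ⊤ := hX B fun x hx => by
      have := Submodule.sub_projection_mem hAB x
      rwa [h x hx, sub_zero] at this
    rw [hB] at hAB
    exact eq_bot_of_isCompl_top hAB
  · right
    have hA : A = ⊤ := hX A fun x hx => by
      obtain ⟨u, hu⟩ := h x hx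
      rw [← hu]
      exact A.smul_mem u (Submodule.projection_apply_mem hAB x)
    rw [hA] at hAB
    exact eq_bot_of_top_isCompl hAB

end Indecomposability

/-! ### Endomorphisms of a homogeneous component are scalars -/

section Endomorphisms

variable {K : Type*} [Field K] [CharZero K] {m n : ℕ} {q : K} [hl : Fact (3 ≤ qChar q)] {s : ℕ}

/-- The exponent `u + p`, for a tuple `p` without odd entries. -/
def Expo.add (u : Expo m n) (p : Fin (m + n) → ℕ)
    (hp : ∀ i : Fin (m + n), m ≤ (i : ℕ) → p i = 0) : Expo m n :=
  ⟨u.1 + p, fun i hi => by rw [Pi.add_apply, hp i hi]; exact u.2 i hi⟩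

theorem mv_add {N : ℕ} (i j : Fin N) {u : Fin N → ℕ} (p : Fin N → ℕ) (hj : 1 ≤ u j) :
    mv i j (u + p) = mv i j u + p := by
  funext k
  simp only [mv, Pi.add_apply]
  split_ifs <;> subst_vars <;> omega

section Coefficients

variable (φ : homog m n q s →ₗ[SmallU m n q] homog m n q s)

theorem sameWt_of_coeff_ne {a b : Expo m n} (h : (φ (monoAt q s a) : Omega m n q) b ≠ 0) :
    SameWt q b a := by
  intro i
  have e : toSmallU m n q (FreeAlgebra.ι K (Gen.k i)) • monoAt q s a =
      toSmallU m n q (algebraMap K _ (qi m q i ^ a.1 i)) • monoAt q s a := by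
    refine Subtype.ext (Finsupp.ext fun c => ?_)
    rw [coe_gen_smul, coe_algebraMap_smul, genAct, diagOp_apply, Finsupp.smul_apply, smul_eq_mul]
    by_cases hc : (monoAt q s a : Omega m n q) c = 0
    · rw [hc, mul_zero, mul_zero]
    · rw [coe_monoAt_apply_ne hc]
  have e' := congrArg (fun v => (φ v : Omega m n q) b) e
  simp only [map_smul] at e'
  rw [coe_gen_smul, coe_algebraMap_smul, genAct, diagOp_apply, Finsupp.smul_apply,
    smul_eq_mul] at e'
  exact mul_right_cancel₀ h e'

/-- Compare coefficients of `x^(b')` in `φ(g x^a) = g φ(x^a)`. Equal weights make the factors `[a_i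
+ 1]` and `[b_i + 1]` equal, and they cancel. -/
theorem coeff_move {a a' b b' : Expo m n} {i j : Fin (m + n)}
    (hij : (i : ℕ) + 1 = j ∨ (j : ℕ) + 1 = i) (hwt : SameWt q a b) (ha : 1 ≤ a.1 j)
    (hb : 1 ≤ b.1 j) (hi : ¬ qChar q ∣ a.1 i + 1) (ha' : a'.1 = mv i j a.1)
    (hb' : b'.1 = mv i j b.1) :
    (φ (monoAt q s a') : Omega m n q) b' = (φ (monoAt q s a) : Omega m n q) b := by
  obtain ⟨g, hg⟩ := exists_genAct_eq_moveOp q hij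
  have hne : i ≠ j := fin_ne (by omega)
  have e := congrArg (fun v => (φ v : Omega m n q) b')
    (gen_smul_monoAt (s := s) hne hg ha ha')
  simp only [map_smul] at e
  rw [coe_gen_smul, coe_algebraMap_smul, hg, moveOp_apply hne hb hb', Finsupp.smul_apply,
    smul_eq_mul, ← hwt.qInt_eq hl.out i] at e
  exact (mul_left_cancel₀ (fun h0 => hi ((qInt_eq_zero_iff hl.out _).1 h0)) e).symm

/-- The generator kills `x^a` but carries `x^b` to a nonzero multiple of `x^(b')`. -/
theorem coeff_eq_zero_of_move {a b b' : Expo m n} {i j : Fin (m + n)}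
    (hij : (i : ℕ) + 1 = j ∨ (j : ℕ) + 1 = i) (ha : a.1 j = 0) (hb : 1 ≤ b.1 j)
    (hi : ¬ qChar q ∣ b.1 i + 1) (hb' : b'.1 = mv i j b.1) :
    (φ (monoAt q s a) : Omega m n q) b = 0 := by
  obtain ⟨g, hg⟩ := exists_genAct_eq_moveOp q hij
  have hne : i ≠ j := fin_ne (by omega)
  have e := congrArg (fun v => (φ v : Omega m n q) b')
    (gen_smul_monoAt_eq_zero (s := s) hne hg ha)
  simp only [map_smul, map_zero] at e
  rw [coe_gen_smul, hg, moveOp_apply hne hb hb'] at e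
  exact (mul_eq_zero.1 e).resolve_left fun h0 => hi ((qInt_eq_zero_iff hl.out _).1 h0)

/-- A coefficient of an endomorphism is unchanged when both exponents are shifted. -/
theorem coeff_add_eq {p p' : Fin (m + n) → ℕ} (hp : ∀ i : Fin (m + n), m ≤ (i : ℕ) → p i = 0)
    (hp' : ∀ i : Fin (m + n), m ≤ (i : ℕ) → p' i = 0) (hd : ∀ i, qChar q ∣ p i)
    (hwt : ∀ i : Fin (m + n), qi m q i ^ p i = qi m q i ^ p' i) {u u' : Expo m n}
    (h : Relation.EqvGen (Step (qChar q)) u u') :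
    (φ (monoAt q s (u.add p hp)) : Omega m n q) (u.add p' hp') =
      (φ (monoAt q s (u'.add p hp)) : Omega m n q) (u'.add p' hp') := by
  induction h with
  | refl => rfl
  | symm _ _ _ ih => exact ih.symm
  | trans _ _ _ _ _ ih ih' => exact ih.trans ih'
  | rel u u' h =>
    obtain ⟨i, j, hij, hj, hi, h⟩ := h
    -- As `ℓ ∣ p_i`, a step at `u` remains a step at `u + p`; for `p'` the equality of weights
    -- suffices.
    refine (coeff_move φ (i := i) (j := j) hij (fun k => ?_) ?_ ?_ ?_ ?_ ?_).symm
    · change qi m q k ^ (u.1 k + p k) = qi m q k ^ (u.1 k + p' k)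
      rw [pow_add, pow_add, hwt]
    · exact le_trans hj (Nat.le_add_right _ _)
    · exact le_trans hj (Nat.le_add_right _ _)
    · change ¬ qChar q ∣ u.1 i + p i + 1
      rwa [add_right_comm, Nat.dvd_add_left (hd i)]
    · change u'.1 + p = mv i j (u.1 + p)
      rw [mv_add i j p hj, h]
    · change u'.1 + p' = mv i j (u.1 + p')
      rw [mv_add i j p' hj, h]

/-- All of `S` goes into entry `i`, unless `l ∣ S + 1`; then one unit is diverted to a third index,
and `l ∤ S`. -/
theorem exists_expo_room {l : ℕ} (hl : 3 ≤ l) (hmn : 3 ≤ m + n) {i j : Fin (m + n)} (hij : i ≠ j)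
    (him : (i : ℕ) < m) (S : ℕ) :
    ∃ u : Expo m n, ∑ k, u.1 k = S ∧ u.1 j = 0 ∧ ¬ l ∣ u.1 i + 1 := by
  by_cases hS : l ∣ S + 1
  · have h1 := Nat.le_of_dvd (Nat.succ_pos _) hS
    obtain ⟨k, hki, hkj⟩ := exists_ne_ne hmn i j
    refine ⟨⟨Pi.single i (S - 1) + Pi.single k 1, fun t ht => ?_⟩, ?_, ?_, ?_⟩
    · rw [Pi.add_apply, Pi.single_eq_of_ne (fin_ne (by omega)), zero_add, Pi.single_apply]
      split_ifs <;> omega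
    · simp only [Pi.add_apply, Finset.sum_add_distrib, Finset.sum_pi_single', Finset.mem_univ,
        if_true]
      omega
    · simp [hij.symm, hkj.symm]
    · simp only [Pi.add_apply, Pi.single_eq_same, Pi.single_eq_of_ne hki.symm, add_zero]
      rw [Nat.sub_add_cancel (by omega)]
      exact not_dvd_of_dvd_succ (by omega) hS
  · refine ⟨⟨Pi.single i S, fun t ht => ?_⟩, ?_, ?_, ?_⟩
    · rw [Pi.single_eq_of_ne (fin_ne (by omega))]
      exact Nat.zero_le _
    · simp
    · simp [hij.symm]
    · simpa using hS

theorem coeff_eq_zero_of_ne (hm : 2 ≤ m) (hmn : 3 ≤ m + n) {a b : Expo m n} (hab : a ≠ b)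
    (ha : ∑ i, a.1 i = s) : (φ (monoAt q s a) : Omega m n q) b = 0 := by
  have hl0 : 3 ≤ qChar q := hl.out
  by_contra hne
  have hwt := sameWt_of_coeff_ne φ hne
  have hb := sum_eq_of_apply_ne _ hne
  obtain ⟨j, hj⟩ : ∃ j, a.1 j < b.1 j := by
    by_contra hc
    have hle : ∀ i ∈ Finset.univ, b.1 i ≤ a.1 i := fun i _ => not_lt.1 fun h => hc ⟨i, h⟩
    exact hab (Subtype.ext (funext fun i =>
      ((Finset.sum_eq_sum_iff_of_le hle).1 (hb.trans ha.symm) i (Finset.mem_univ i)).symm))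
  have hjm : (j : ℕ) < m := by
    by_contra h
    have := hwt.eq_of_odd hl0 (not_lt.1 h)
    omega
  -- The neighbour is chosen even, which `m ≥ 2` allows, so that it can always receive a unit from
  -- `j`.
  obtain ⟨i, hij, him⟩ : ∃ i : Fin (m + n), ((i : ℕ) + 1 = j ∨ (j : ℕ) + 1 = i) ∧ (i : ℕ) < m := by
    by_cases h : (j : ℕ) = 0
    · exact ⟨⟨1, by omega⟩, Or.inr (by rw [h]), hm⟩
    · exact ⟨⟨j - 1, by omega⟩, Or.inl (by simp only []; omega), by simp only []; omega⟩
  have hij' : i ≠ j := fin_ne (by omega)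
  -- The common part of `a` and `b`; the remainders `p`, `p'` have disjoint supports, entries
  -- divisible by `ℓ`, and equal weights.
  set u : Expo m n := ⟨fun k => min (a.1 k) (b.1 k), fun k hk => min_le_of_left_le (a.2 k hk)⟩
    with hu
  set p : Fin (m + n) → ℕ := fun k => a.1 k - b.1 k with hpdef
  set p' : Fin (m + n) → ℕ := fun k => b.1 k - a.1 k with hpdef'
  have hp : ∀ k : Fin (m + n), m ≤ (k : ℕ) → p k = 0 := fun k hk => by
    simp [hpdef, hwt.eq_of_odd hl0 hk]
  have hp' : ∀ k : Fin (m + n), m ≤ (k : ℕ) → p' k = 0 := fun k hk => by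
    simp [hpdef', hwt.eq_of_odd hl0 hk]
  have hup : u.add p hp = a := Subtype.ext (funext fun k => by
    change min (a.1 k) (b.1 k) + (a.1 k - b.1 k) = a.1 k
    omega)
  have hup' : u.add p' hp' = b := Subtype.ext (funext fun k => by
    change min (a.1 k) (b.1 k) + (b.1 k - a.1 k) = b.1 k
    omega)
  have hd : ∀ {x y : Expo m n}, SameWt q x y → ∀ k, qChar q ∣ x.1 k - y.1 k := by
    intro x y h k
    by_cases hk : (k : ℕ) < m
    · rcases le_total (x.1 k) (y.1 k) with hle | hle
      · rw [Nat.sub_eq_zero_of_le hle]; exact dvd_zero _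
      · exact (Nat.modEq_iff_dvd' hle).1 (h.modEq hl0 hk).symm
    · rw [h.eq_of_odd hl0 (not_lt.1 hk), Nat.sub_self]; exact dvd_zero _
  have hwp : ∀ k : Fin (m + n), qi m q k ^ p k = qi m q k ^ p' k := fun k => by
    have h1 : a.1 k = u.1 k + p k := congrFun (congrArg Subtype.val hup.symm) k
    have h2 : b.1 k = u.1 k + p' k := congrFun (congrArg Subtype.val hup'.symm) k
    have h3 := hwt k
    rw [h1, h2, pow_add, pow_add] at h3
    exact (mul_left_cancel₀ (pow_ne_zero _ (qi_ne (q_facts hl0).1 m k)) h3).symm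
  -- With `u₀` in place of `u`, entry `j` of `u₀ + p` is `0` because `p_j = 0`, while entry `j` of
  -- `u₀ + p'` is positive, and the move from `j` to `i` has a nonzero coefficient on the latter.
  obtain ⟨u₀, hs₀, hj₀, hi₀⟩ := exists_expo_room hl0 hmn hij' him (∑ k, u.1 k)
  have key := coeff_add_eq φ hp hp' (hd fun k => (hwt k).symm) hwp
    (eqvGen_of_sum_eq hl0 (by omega) hmn hs₀.symm)
  rw [hup, hup'] at key
  refine hne (key.trans (coeff_eq_zero_of_move φ (i := i) (j := j)
    (b' := (u₀.add p' hp').mv i j fun h => by omega) hij ?_ ?_ ?_ rfl))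
  · change u₀.1 j + (a.1 j - b.1 j) = 0
    omega
  · change 1 ≤ u₀.1 j + (b.1 j - a.1 j)
    omega
  · change ¬ qChar q ∣ u₀.1 i + (b.1 i - a.1 i) + 1
    rwa [add_right_comm, Nat.dvd_add_left (hd hwt i)]

theorem coeff_self_eq (hm : 2 ≤ m) (hmn : 3 ≤ m + n) {a b : Expo m n}
    (h : ∑ i, a.1 i = ∑ i, b.1 i) :
    (φ (monoAt q s a) : Omega m n q) a = (φ (monoAt q s b) : Omega m n q) b :=
  coeff_add_eq φ (p := 0) (p' := 0) (fun _ _ => rfl) (fun _ _ => rfl) (fun _ => dvd_zero _)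
    (fun _ => rfl) (eqvGen_of_sum_eq hl.out (by omega) hmn h)

/-- The endomorphisms of a homogeneous component are scalars. -/
theorem exists_eq_algebraMap_smul (hm : 2 ≤ m) (hmn : 3 ≤ m + n) :
    ∃ c : K, ∀ a : Expo m n, φ (monoAt q s a) =
      toSmallU m n q (algebraMap K _ c) • monoAt q s a := by
  obtain ⟨a₀, ha₀, -⟩ := exists_energy_eq_div (n := n) (show 0 < m by omega) (qChar q) s
  refine ⟨(φ (monoAt q s a₀) : Omega m n q) a₀, fun a => ?_⟩
  by_cases ha : ∑ i, a.1 i = s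
  · refine Subtype.ext (Finsupp.ext fun b => ?_)
    rw [coe_algebraMap_smul, coe_monoAt ha, Finsupp.smul_apply, smul_eq_mul]
    by_cases hab : a = b
    · subst hab
      rw [Finsupp.single_eq_same, mul_one, coeff_self_eq φ hm hmn (ha.trans ha₀.symm)]
    · rw [coeff_eq_zero_of_ne φ hm hmn hab ha, Finsupp.single_eq_of_ne (Ne.symm hab), mul_zero]
  · rw [monoAt, dif_neg ha, map_zero, smul_zero]

end Coefficients

theorem isIndecomposable_homog (hm : 2 ≤ m) (hmn : 3 ≤ m + n) :
    IsIndecomposable (SmallU m n q) (homog m n q s) := by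
  obtain ⟨a₀, ha₀, -⟩ := exists_energy_eq_div (n := n) (show 0 < m by omega) (qChar q) s
  have hne : monoAt q s a₀ ≠ 0 := fun h => by
    have := coe_monoAt (q := q) ha₀
    rw [h] at this
    exact one_ne_zero (Finsupp.single_eq_zero.1 this.symm)
  refine isIndecomposable_of_endomorphisms (Set.range (monoAt q s)) ⟨_, ⟨a₀, rfl⟩, hne⟩
    (fun N h => (Submodule.eq_top_iff').2 fun _ => mem_of_monoAt_mem fun a _ => h ⟨a, rfl⟩)
    fun φ => ?_
  obtain ⟨c, hc⟩ := exists_eq_algebraMap_smul φ hm hmn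
  by_cases h0 : c = 0
  · left
    rintro _ ⟨a, rfl⟩
    rw [hc, h0, map_zero, map_zero, zero_smul]
  · right
    rintro _ ⟨a, rfl⟩
    refine ⟨toSmallU m n q (algebraMap K _ c⁻¹), ?_⟩
    rw [hc, smul_smul, ← map_mul, ← map_mul, inv_mul_cancel₀ h0, map_one, map_one, one_smul]

end Endomorphisms
end QGrass

theorem corollary27 {K : Type*} [Field K] [IsAlgClosed K] [CharZero K]
    (m n : ℕ) (hm : 2 ≤ m) (hmn : 3 ≤ m + n)
    (q : K) [Fact (3 ≤ QGrass.qChar q)] (s : ℕ) :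
    QGrass.IsIndecomposable (QGrass.SmallU m n q) (QGrass.homog m n q s) ∧
      QGrass.IsRigid (QGrass.SmallU m n q) (QGrass.homog m n q s) :=
  ⟨QGrass.isIndecomposable_homog hm hmn, QGrass.isRigid_homog (by omega)⟩
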